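/- Notation. A partition of $[-1,1]$ is a sequence $\mathbf z=(z_i)_{i=0}^n$ with $-1=z_0<z_1<\dots<z_n=1$. For such $\mathbf z$, set $z_{-1}:=z_0$, $z_{n+1}:=z_n$ and $\mathcal J_j:=[(z_{j-1}+z_j)/2,\,(z_j+z_{j+1})/2]$, $0\le j\le n$. A piecewise polynomial function of degree $\le d$ on $\mathbf z$ is a function that coincides on each $(z_i,z_{i+1})$, $0\le i\le n-1$, with an algebraic polynomial of degree $\le d$; it is a spline of minimal defect if it also belongs to $C^{d-1}[-1,1]$. A function $f$ is $q$-monotone on $[-1,1]$ if $[f;t_0,\dots,t_q]\ge 0$ for all distinct $t_0,\dots,t_q\in[-1,1]$, where $[f;t_0,\dots,t_q]$ is the divided difference of order $q$. A partition $\tilde{\mathbf z}=(\tilde z_i)_{i=0}^m$ of $[-1,1]$ is a $\delta$-remesh of $\mathbf z$ if, for each $0\le j\le n-1$, every interval $[\tilde z_i,\tilde z_{i+1}]$ that intersects $(z_j,z_{j+1})$ satisfies $\tilde z_{i+1}-\tilde z_i\le\delta\,(z_{\nu+1}-z_\nu)$ for all $\nu\in\{j-1,j,j+1\}$ with $0\le\nu\le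 n-1$. For an interval $J$ of length $|J|$ and $0<p\le\infty$, let $$\omega_k(f,J)_p:=\sup_{0<h\le |J|}\|\Delta_h^k(f,\cdot,J)\|_{L_p(J)},$$ where $\Delta_h^k(f,x,J):=\sum_{i=0}^k\binom ki(-1)^{k-i}f(x-kh/2+ih)$ if $x\pm kh/2\in J$, and $\Delta_h^k(f,x,J):=0$ otherwise. Theorem. Let $q,r\ge 1$ be integers. There are a constant $\delta>0$, depending only on $q$ and $r$, and finite constants $c(p,q,r)$, $0<p\le\infty$, depending only on $p$, $q$ and $r$, with the following property. Let $\mathbf z=(z_i)_{i=0}^n$ be a partition of $[-1,1]$, let $s\in C^{q-1}[-1,1]$ be a $q$-monotone (on $[-1,1]$) piecewise polynomial function of degree $\le q+r$ on $\mathbf z$, and let $\tilde{\mathbf z}=(\tilde z_i)_{i=0}^m$ be a $\delta$-remesh of $\mathbf z$. Then there is a $q$-monotone (on $[-1,1]$) spline $\tilde s\in C^{q+r-1}[-1,1]$ of degree $\le q+r$ and of minimal defect on $\tilde{\mathbf z}$, not depending on $p$, such that $$\|s-\tilde s\|_{L_p(\mathcal J_j)}\le c(p,q,r)\,\omega_{q+r+1}(s,\mathcal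 J_j)_p\qquad\text{for all }0\le j\le n\text{ and all }0<p\le\infty.$$ -/

import Mathlib

open MeasureTheory
open scoped ENNReal

namespace SplineSmoothing

/-- The knots `z 0, …, z n` form a partition `-1 = z₀ < z₁ < ⋯ < zₙ = 1` of `[-1, 1]`
(values `z i` with `i > n` play no role; `0 < n` is automatic). -/
def IsPartition (n : ℕ) (z : ℕ → ℝ) : Prop :=
  z 0 = -1 ∧ z n = 1 ∧ ∀ i < n, z i < z (i + 1)

/-- `s` is a piecewise polynomial function of degree `≤ d` with knots `z 0, …, z n`:
on each open interval `(zᵢ, zᵢ₊₁)` it agrees with a polynomial of degree `≤ d`. -/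
def IsPPF (d n : ℕ) (z : ℕ → ℝ) (s : ℝ → ℝ) : Prop :=
  ∀ i < n, ∃ P : Polynomial ℝ, P.natDegree ≤ d ∧
    ∀ x ∈ Set.Ioo (z i) (z (i + 1)), s x = P.eval x

/-- `s` is a spline of degree `≤ d` of minimal defect with knots `z 0, …, z n`:
a piecewise polynomial function of degree `≤ d` that belongs to `C^{d-1}[-1, 1]`
(used for `d ≥ 1` only). -/
def IsMinDefectSpline (d n : ℕ) (z : ℕ → ℝ) (s : ℝ → ℝ) : Prop :=
  IsPPF d n z s ∧ ContDiffOn ℝ ((d - 1 : ℕ) : ℕ∞) s (Set.Icc (-1) 1)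

/-- The divided difference `[f; t₀, …, t_q]` of order `q` (the points are meant to be distinct). -/
noncomputable def dividedDiff (q : ℕ) (f : ℝ → ℝ) (t : Fin (q + 1) → ℝ) : ℝ :=
  ∑ i, f (t i) / ∏ j ∈ Finset.univ.erase i, (t i - t j)

/-- `f` is `q`-monotone on `J`: all its divided differences of order `q` at distinct points of `J`
are nonnegative. -/
def QMonotoneOn (q : ℕ) (f : ℝ → ℝ) (J : Set ℝ) : Prop :=
  ∀ t : Fin (q + 1) → ℝ, Function.Injective t → (∀ i, t i ∈ J) → 0 ≤ dividedDiff q f t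

/-- `w 0, …, w m` is a `δ`-remesh of `z 0, …, z n`: it is a partition of `[-1, 1]`, and every
interval `[wᵢ, wᵢ₊₁]` that meets `(zⱼ, zⱼ₊₁)` has length at most `δ` times the length of
each of those of `[zⱼ₋₁, zⱼ]`, `[zⱼ, zⱼ₊₁]`, `[zⱼ₊₁, zⱼ₊₂]` that exist. -/
def IsRemesh (δ : ℝ) (n : ℕ) (z : ℕ → ℝ) (m : ℕ) (w : ℕ → ℝ) : Prop :=
  IsPartition m w ∧ ∀ j < n, ∀ i < m,
    (Set.Icc (w i) (w (i + 1)) ∩ Set.Ioo (z j) (z (j + 1))).Nonempty →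
      ∀ ν < n, (ν + 1 = j ∨ ν = j ∨ ν = j + 1) → w (i + 1) - w i ≤ δ * (z (ν + 1) - z ν)

open Classical in
/-- The symmetric difference `Δ_h^k(f, x, J)`, equal to `0` unless `x ± kh/2 ∈ J`. -/
noncomputable def symmDiffOn (k : ℕ) (h : ℝ) (f : ℝ → ℝ) (J : Set ℝ) (x : ℝ) : ℝ :=
  if x - k * h / 2 ∈ J ∧ x + k * h / 2 ∈ J then
    ∑ i ∈ Finset.range (k + 1),
      (k.choose i : ℝ) * (-1) ^ (k - i) * f (x - k * h / 2 + i * h)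
  else 0

/-- The `k`-th modulus of smoothness `ω_k(f, t, J)_p = sup_{0 < h ≤ t} ‖Δ_h^k(f, ·, J)‖_{L_p(J)}`,
as an extended nonnegative real number. -/
noncomputable def modulus (k : ℕ) (f : ℝ → ℝ) (t : ℝ) (J : Set ℝ) (p : ℝ≥0∞) : ℝ≥0∞ :=
  ⨆ h ∈ Set.Ioc 0 t, eLpNorm (symmDiffOn k h f J) p (volume.restrict J)

/-- `ω_k(f, J)_p = ω_k(f, |J|, J)_p`, where `|J|` is the length of `J`. -/
noncomputable def modulusOn (k : ℕ) (f : ℝ → ℝ) (J : Set ℝ) (p : ℝ≥0∞) : ℝ≥0∞ :=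
  modulus k f (volume.real J) J p

/-- `𝒥_j = [(z_{j-1} + z_j)/2, (z_j + z_{j+1})/2]` for `0 ≤ j ≤ n`, with the conventions
`z_{-1} = z_0` (here `0 - 1 = 0` in `ℕ`) and `z_{n+1} = z_n`. -/
def midInterval (n : ℕ) (z : ℕ → ℝ) (j : ℕ) : Set ℝ :=
  Set.Icc ((z (j - 1) + z j) / 2) ((z j + z (min (j + 1) n)) / 2)

end SplineSmoothing

namespace SplineSmoothing

open Polynomial

/-- The spline `x ↦ ∑ c (x - w)₊ᵏ` attached to the finitely supported weight `w ↦ c`. -/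
noncomputable def spl (k : ℕ) : (ℝ →₀ ℝ) →ₗ[ℝ] (ℝ → ℝ) :=
  Finsupp.linearCombination ℝ fun w x => max (x - w) 0 ^ k

/-- The polynomial `∑ c (X - w)ᵏ` attached to the finitely supported weight `w ↦ c`. -/
noncomputable def powSum (k : ℕ) : (ℝ →₀ ℝ) →ₗ[ℝ] ℝ[X] :=
  Finsupp.linearCombination ℝ fun w => (X - C w) ^ k

/-- The total mass of a finitely supported weight. -/
noncomputable def mass (μ : ℝ →₀ ℝ) : ℝ := μ.sum fun _ c => |c|

/-- The `ℓ¹` norm of the coefficients up to degree `d`. -/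
noncomputable def coeffNorm (d : ℕ) (P : ℝ[X]) : ℝ := ∑ i ∈ Finset.range (d + 1), |P.coeff i|

theorem spl_apply (k : ℕ) (μ : ℝ →₀ ℝ) (x : ℝ) :
    spl k μ x = ∑ w ∈ μ.support, μ w * max (x - w) 0 ^ k := by
  simp [spl, Finsupp.linearCombination_apply, Finsupp.sum]

theorem powSum_apply (k : ℕ) (μ : ℝ →₀ ℝ) :
    powSum k μ = ∑ w ∈ μ.support, C (μ w) * (X - C w) ^ k := by
  simp [powSum, Finsupp.linearCombination_apply, Finsupp.sum, smul_eq_C_mul]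

theorem eval_powSum (k : ℕ) (μ : ℝ →₀ ℝ) (x : ℝ) :
    (powSum k μ).eval x = ∑ w ∈ μ.support, μ w * (x - w) ^ k := by
  simp [powSum_apply, eval_finsetSum]

theorem natDegree_powSum_le (k : ℕ) (μ : ℝ →₀ ℝ) : (powSum k μ).natDegree ≤ k := by
  rw [powSum_apply]
  refine natDegree_sum_le_of_forall_le _ _ fun w _ => ?_
  refine (natDegree_C_mul_le _ _).trans ?_
  rw [natDegree_pow, natDegree_X_sub_C, mul_one]

theorem mass_nonneg (μ : ℝ →₀ ℝ) : 0 ≤ mass μ :=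
  Finset.sum_nonneg fun _ _ => abs_nonneg _

theorem mass_add_le (μ ν : ℝ →₀ ℝ) : mass (μ + ν) ≤ mass μ + mass ν := by
  classical
  have h : ∀ ξ : ℝ →₀ ℝ, ξ.support ⊆ μ.support ∪ ν.support →
      mass ξ = ∑ w ∈ μ.support ∪ ν.support, |ξ w| := fun ξ hξ =>
    Finsupp.sum_of_support_subset _ hξ _ (by simp)
  rw [h μ Finset.subset_union_left, h ν Finset.subset_union_right,
    h (μ + ν) Finsupp.support_add, ← Finset.sum_add_distrib]
  exact Finset.sum_le_sum fun w _ => abs_add_le _ _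

theorem mass_smul (a : ℝ) (μ : ℝ →₀ ℝ) : mass (a • μ) = |a| * mass μ := by
  rw [mass, Finsupp.sum_smul_index' (by simp), mass, Finsupp.mul_sum]
  simp [abs_mul]

theorem mass_neg (μ : ℝ →₀ ℝ) : mass (-μ) = mass μ := by
  have := mass_smul (-1) μ
  simpa using this

theorem mass_sub_le (μ ν : ℝ →₀ ℝ) : mass (μ - ν) ≤ mass μ + mass ν := by
  rw [sub_eq_add_neg, ← mass_neg ν]
  exact mass_add_le _ _

theorem mass_single (w c : ℝ) : mass (Finsupp.single w c) = |c| := by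
  simp [mass]

theorem spl_eq_zero {k : ℕ} (hk : 1 ≤ k) {μ : ℝ →₀ ℝ} {x : ℝ}
    (hμ : ∀ w ∈ μ.support, x ≤ w) : spl k μ x = 0 := by
  rw [spl_apply]
  refine Finset.sum_eq_zero fun w hw => ?_
  rw [max_eq_right (sub_nonpos.2 (hμ w hw)), zero_pow (by lia), mul_zero]

theorem spl_eq_eval {k : ℕ} {μ : ℝ →₀ ℝ} {x : ℝ}
    (hμ : ∀ w ∈ μ.support, w ≤ x) : spl k μ x = (powSum k μ).eval x := by
  rw [spl_apply, eval_powSum]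
  refine Finset.sum_congr rfl fun w hw => ?_
  rw [max_eq_left (sub_nonneg.2 (hμ w hw))]

theorem abs_spl_le (k : ℕ) {μ : ℝ →₀ ℝ} {x R : ℝ} (hR : 0 ≤ R)
    (hμ : ∀ w ∈ μ.support, x - w ≤ R) : |spl k μ x| ≤ R ^ k * mass μ := by
  rw [spl_apply, mass, Finsupp.mul_sum]
  refine (Finset.abs_sum_le_sum_abs _ _).trans (Finset.sum_le_sum fun w hw => ?_)
  rw [abs_mul, abs_of_nonneg (pow_nonneg (le_max_right (x - w) 0) k), mul_comm]
  exact mul_le_mul_of_nonneg_right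
    (pow_le_pow_left₀ (le_max_right _ _) (max_le (hμ w hw) hR) _) (abs_nonneg _)

theorem hasDerivAt_max_pow (k : ℕ) (w x : ℝ) :
    HasDerivAt (fun x : ℝ => max (x - w) 0 ^ (k + 2)) ((k + 2) * max (x - w) 0 ^ (k + 1)) x := by
  have hp : HasDerivAt (fun x : ℝ => (x - w) ^ (k + 2)) ((k + 2) * (x - w) ^ (k + 1)) x := by
    have := ((hasDerivAt_id x).sub_const w).fun_pow (k + 2)
    simpa using this
  rcases lt_trichotomy x w with h | h | h
  · rw [max_eq_right (by linarith), zero_pow (by lia), mul_zero]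
    refine (hasDerivAt_const x (0 : ℝ)).congr_of_eventuallyEq ?_
    filter_upwards [Iio_mem_nhds h] with y hy
    rw [max_eq_right (sub_nonpos.2 (le_of_lt hy)), zero_pow (by lia)]
  · subst h
    rw [sub_self, max_self, zero_pow (by lia), mul_zero]
    have h0 : HasDerivAt (fun y : ℝ => (y - x) ^ (k + 2)) 0 x := by
      simpa using hp
    rw [hasDerivAt_iff_isLittleO] at h0 ⊢
    refine Asymptotics.IsBigO.trans_isLittleO (Asymptotics.IsBigO.of_bound 1 ?_) h0
    filter_upwards with y
    simp only [sub_self, max_self, smul_zero, sub_zero, ne_eq, Nat.add_eq_zero_iff,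
      OfNat.ofNat_ne_zero, and_false, not_false_eq_true, zero_pow, norm_pow, one_mul]
    gcongr
    rw [Real.norm_eq_abs, Real.norm_eq_abs, abs_of_nonneg (le_max_right _ _)]
    exact max_le (le_abs_self _) (abs_nonneg _)
  · rw [max_eq_left (by linarith)]
    refine hp.congr_of_eventuallyEq ?_
    filter_upwards [Ioi_mem_nhds h] with y hy
    rw [max_eq_left (sub_nonneg.2 (le_of_lt hy))]

theorem hasDerivAt_spl (k : ℕ) (μ : ℝ →₀ ℝ) (x : ℝ) :
    HasDerivAt (spl (k + 2) μ) ((k + 2) * spl (k + 1) μ x) x := by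
  have h : spl (k + 2) μ = fun x => ∑ w ∈ μ.support, μ w * max (x - w) 0 ^ (k + 2) :=
    funext fun x => spl_apply _ _ _
  rw [h, spl_apply, Finset.mul_sum]
  refine HasDerivAt.fun_sum fun w _ => ?_
  rw [mul_left_comm]
  exact (hasDerivAt_max_pow k w x).const_mul (μ w)

theorem deriv_spl (k : ℕ) (μ : ℝ →₀ ℝ) :
    deriv (spl (k + 2) μ) = ((k : ℝ) + 2) • spl (k + 1) μ :=
  funext fun x => (hasDerivAt_spl k μ x).deriv

theorem continuous_spl (k : ℕ) (μ : ℝ →₀ ℝ) : Continuous (spl k μ) := by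
  have h : spl k μ = fun x => ∑ w ∈ μ.support, μ w * max (x - w) 0 ^ k :=
    funext fun x => spl_apply _ _ _
  rw [h]
  fun_prop

theorem contDiff_spl (k : ℕ) (μ : ℝ →₀ ℝ) : ContDiff ℝ k (spl (k + 1) μ) := by
  induction k with
  | zero => exact contDiff_zero.2 (continuous_spl _ _)
  | succ k ih =>
    push_cast
    refine contDiff_succ_iff_deriv.2 ⟨fun x => (hasDerivAt_spl k μ x).differentiableAt, ?_, ?_⟩
    · intro h
      simp at h
    · rw [deriv_spl]
      exact contDiff_const.smul ih

theorem iteratedDeriv_spl (q r : ℕ) (hr : 1 ≤ r) (μ : ℝ →₀ ℝ) :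
    iteratedDeriv q (spl (q + r) μ) = ((q + r).descFactorial q : ℝ) • spl r μ := by
  induction q with
  | zero => simp
  | succ q ih =>
    obtain ⟨r, rfl⟩ : ∃ r', r = r' + 1 := ⟨r - 1, by lia⟩
    rw [iteratedDeriv_succ', show q + 1 + (r + 1) = (q + r) + 2 by ring, deriv_spl,
      show (((q + r : ℕ) : ℝ) + 2) • spl (q + r + 1) μ
        = fun x => (((q + r : ℕ) : ℝ) + 2) • spl (q + r + 1) μ x from rfl]
    have hc : iteratedDeriv q (fun x => (((q + r : ℕ) : ℝ) + 2) • spl (q + r + 1) μ x)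
        = (((q + r : ℕ) : ℝ) + 2) • iteratedDeriv q (spl (q + r + 1) μ) := by
      funext x
      simp only [smul_eq_mul, Pi.smul_apply]
      exact iteratedDeriv_const_mul_field _ _
    rw [hc, show q + r + 1 = q + (r + 1) by ring, ih, smul_smul,
      show q + r + 2 = (q + (r + 1)) + 1 by ring, Nat.succ_descFactorial_succ]
    push_cast
    congr 1
    ring

theorem iterate_derivative_powSum (q r : ℕ) (μ : ℝ →₀ ℝ) :
    derivative^[q] (powSum (q + r) μ) = ((q + r).descFactorial q : ℝ) • powSum r μ := by
  rw [powSum_apply, powSum_apply, iterate_derivative_sum, Finset.smul_sum]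
  refine Finset.sum_congr rfl fun w _ => ?_
  rw [iterate_derivative_C_mul, iterate_derivative_X_sub_pow, Nat.add_sub_cancel_left]
  rw [smul_eq_C_mul, nsmul_eq_mul]
  simp only [map_natCast]
  ring

/-- The image of a weight under `t ↦ z + h t`. -/
noncomputable def affineMap (z h : ℝ) (μ : ℝ →₀ ℝ) : ℝ →₀ ℝ :=
  Finsupp.mapDomain (fun t => z + h * t) μ

theorem spl_affineMap (k : ℕ) {z h : ℝ} (hh : 0 ≤ h) (μ : ℝ →₀ ℝ) (t : ℝ) :
    spl k (affineMap z h μ) (z + h * t) = h ^ k * spl k μ t := by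
  rw [spl, affineMap, Finsupp.linearCombination_mapDomain, ← spl, spl_apply, Finset.mul_sum,
    Finsupp.linearCombination_apply, Finsupp.sum]
  simp only [Finset.sum_apply, Pi.smul_apply, Function.comp_apply, smul_eq_mul]
  refine Finset.sum_congr rfl fun w _ => ?_
  rw [show z + h * t - (z + h * w) = h * (t - w) by ring,
    show max (h * (t - w)) 0 = h * max (t - w) 0 by
      rw [mul_max_of_nonneg _ _ hh, mul_zero], mul_pow]
  ring

theorem eval_powSum_affineMap (k : ℕ) (z h : ℝ) (μ : ℝ →₀ ℝ) (t : ℝ) :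
    (powSum k (affineMap z h μ)).eval (z + h * t) = h ^ k * (powSum k μ).eval t := by
  rw [powSum, affineMap, Finsupp.linearCombination_mapDomain, ← powSum, eval_powSum,
    Finset.mul_sum, Finsupp.linearCombination_apply, Finsupp.sum, eval_finsetSum]
  refine Finset.sum_congr rfl fun w _ => ?_
  simp only [Function.comp_apply, eval_smul, eval_pow, eval_sub, eval_X, eval_C, smul_eq_mul]
  rw [show z + h * t - (z + h * w) = h * (t - w) by ring, mul_pow]
  ring

theorem mass_affineMap {z h : ℝ} (hh : h ≠ 0) (μ : ℝ →₀ ℝ) : mass (affineMap z h μ) = mass μ := by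
  have hinj : Function.Injective fun t : ℝ => z + h * t := fun a b hab => by
    simpa [hh] using hab
  exact Finsupp.sum_mapDomain_index_inj hinj

theorem exists_of_mem_support_affineMap {z h : ℝ} {μ : ℝ →₀ ℝ} {w : ℝ}
    (hw : w ∈ (affineMap z h μ).support) : ∃ t ∈ μ.support, w = z + h * t := by
  classical
  have := Finsupp.mapDomain_support hw
  obtain ⟨t, ht, rfl⟩ := Finset.mem_image.1 this
  exact ⟨t, ht, rfl⟩

theorem exists_polynomial_eq_spl {k : ℕ} (hk : 1 ≤ k) (μ : ℝ →₀ ℝ) {a b : ℝ}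
    (h : ∀ w ∈ μ.support, w ∉ Set.Ioo a b) :
    ∃ P : ℝ[X], P.natDegree ≤ k ∧ ∀ x ∈ Set.Ioo a b, spl k μ x = P.eval x := by
  refine ⟨powSum k (μ.filter (· ≤ a)), natDegree_powSum_le _ _, fun x hx => ?_⟩
  conv_lhs => rw [← Finsupp.filter_add_filter_not μ (· ≤ a)]
  rw [map_add, Pi.add_apply, spl_eq_eval, spl_eq_zero hk, add_zero]
  · intro w hw
    rw [Finsupp.support_filter, Finset.mem_filter] at hw
    by_contra hxw
    exact h w hw.1 ⟨not_le.1 hw.2, (not_le.1 hxw).trans hx.2⟩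
  · intro w hw
    rw [Finsupp.support_filter, Finset.mem_filter] at hw
    exact hw.2.trans hx.1.le

theorem coeffNorm_nonneg (d : ℕ) (P : ℝ[X]) : 0 ≤ coeffNorm d P :=
  Finset.sum_nonneg fun _ _ => abs_nonneg _

theorem abs_coeff_le_coeffNorm {d : ℕ} (P : ℝ[X]) {i : ℕ} (hi : i ≤ d) :
    |P.coeff i| ≤ coeffNorm d P :=
  Finset.single_le_sum (f := fun i => |P.coeff i|) (fun _ _ => abs_nonneg _)
    (Finset.mem_range.2 (by lia))

theorem coeffNorm_sub_le (d : ℕ) (P Q : ℝ[X]) :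
    coeffNorm d (P - Q) ≤ coeffNorm d P + coeffNorm d Q := by
  rw [coeffNorm, coeffNorm, coeffNorm, ← Finset.sum_add_distrib]
  refine Finset.sum_le_sum fun i _ => ?_
  rw [coeff_sub]
  exact abs_sub _ _

theorem coeffNorm_le_of_coeff_le {d : ℕ} {P : ℝ[X]} {B : ℝ} (h : ∀ i ≤ d, |P.coeff i| ≤ B) :
    coeffNorm d P ≤ (d + 1) * B := by
  refine (Finset.sum_le_card_nsmul _ _ B fun i hi => h i ?_).trans ?_
  · exact Nat.lt_succ_iff.1 (Finset.mem_range.1 hi)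
  · simp

theorem abs_eval_le_coeffNorm {d : ℕ} {P : ℝ[X]} (hP : P.natDegree ≤ d) {x : ℝ} (hx : |x| ≤ 1) :
    |P.eval x| ≤ coeffNorm d P := by
  rw [eval_eq_sum_range' (Nat.lt_succ_of_le hP)]
  refine (Finset.abs_sum_le_sum_abs _ _).trans (Finset.sum_le_sum fun i _ => ?_)
  rw [abs_mul, abs_pow]
  exact mul_le_of_le_one_right (abs_nonneg _) (pow_le_one₀ (abs_nonneg _) hx)

theorem abs_eval_sub_eval_le {d : ℕ} {P : ℝ[X]} (hP : P.natDegree ≤ d) {x y : ℝ} (hx : |x| ≤ 1)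
    (hy : |y| ≤ 1) : |P.eval x - P.eval y| ≤ d * |x - y| * coeffNorm d P := by
  rw [eval_eq_sum_range' (Nat.lt_succ_of_le hP), eval_eq_sum_range' (Nat.lt_succ_of_le hP),
    ← Finset.sum_sub_distrib, coeffNorm, Finset.mul_sum]
  refine (Finset.abs_sum_le_sum_abs _ _).trans (Finset.sum_le_sum fun i hi => ?_)
  rw [← mul_sub, abs_mul, mul_comm]
  refine mul_le_mul_of_nonneg_right ?_ (abs_nonneg _)
  have hi' : (i : ℝ) ≤ d := by exact_mod_cast Nat.lt_succ_iff.1 (Finset.mem_range.1 hi)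
  calc |x ^ i - y ^ i| ≤ |x - y| * i * max |x| |y| ^ (i - 1) := abs_pow_sub_pow_le _ _ _
    _ ≤ |x - y| * i * 1 := by
        gcongr
        exact pow_le_one₀ (le_max_of_le_left (abs_nonneg _)) (max_le hx hy)
    _ ≤ |x - y| * d := by
        rw [mul_one]; gcongr
    _ = d * |x - y| := mul_comm _ _

theorem exists_coeffNorm_le_abs_eval (d : ℕ) {v : Fin (d + 1) → ℝ} (hv : Function.Injective v) :
    ∃ c > 0, ∀ P : ℝ[X], P.natDegree ≤ d → ∃ i, c * coeffNorm d P ≤ |P.eval (v i)| := by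
  set f : (Fin (d + 1) → ℝ) →ₗ[ℝ] (Fin (d + 1) → ℝ) := (Matrix.vandermonde v).mulVecLin with hf
  have hinj : LinearMap.ker f = ⊥ := by
    rw [LinearMap.ker_eq_bot, hf]
    have hdet : IsUnit (Matrix.vandermonde v) :=
      (Matrix.isUnit_iff_isUnit_det _).2 (Matrix.det_vandermonde_ne_zero_iff.2 hv).isUnit
    exact Matrix.mulVec_injective_iff_isUnit.2 hdet
  obtain ⟨K, hK, hanti⟩ := f.exists_antilipschitzWith hinj
  refine ⟨1 / (K * (d + 1)), by positivity, fun P hP => ?_⟩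
  by_contra! hcon
  set N := coeffNorm d P with hN
  have hNpos : 0 < N := by
    have h0 := (abs_nonneg _).trans_lt (hcon 0)
    exact pos_of_mul_pos_right h0 (by positivity)
  set c : Fin (d + 1) → ℝ := fun i => P.coeff i with hc
  have hfc : ∀ i, f c i = P.eval (v i) := fun i => by
    rw [eval_eq_sum_range' (Nat.lt_succ_of_le hP), ← Fin.sum_univ_eq_sum_range
      (fun j => P.coeff j * v i ^ j)]
    simp [hf, Matrix.mulVec, dotProduct, hc, mul_comm]
  have h1 : ‖c‖ ≤ K * ‖f c‖ := by
    have := hanti.le_mul_dist c 0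
    simpa using this
  have h2 : ‖f c‖ < 1 / (K * (d + 1)) * N :=
    (pi_norm_lt_iff (by positivity)).2 fun i => by
      rw [hfc, Real.norm_eq_abs]; exact hcon i
  have h3 : N ≤ (d + 1) * ‖c‖ := by
    refine coeffNorm_le_of_coeff_le fun i hi => ?_
    exact norm_le_pi_norm c ⟨i, Nat.lt_succ_of_le hi⟩
  have hK' : (0 : ℝ) < K := hK
  have h4 : (d + 1) * ‖c‖ < N := by
    calc (d + 1) * ‖c‖ ≤ (d + 1) * (K * ‖f c‖) := by gcongr
      _ < (d + 1) * (K * (1 / (K * (d + 1)) * N)) := by gcongr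
      _ = N := by field_simp
  linarith

/-- A polynomial is comparable with its coefficient norm on some subinterval of `[0, a]` whose
length depends on the degree and on `a` only. -/
theorem exists_Icc_coeffNorm_le (d : ℕ) {a : ℝ} (ha : 0 < a) (ha1 : a ≤ 1) :
    ∃ c > 0, ∃ ρ > 0, ρ ≤ a ∧ ∀ P : ℝ[X], P.natDegree ≤ d → ∃ x₀, 0 ≤ x₀ ∧ x₀ + ρ ≤ a ∧
      ∀ x ∈ Set.Icc x₀ (x₀ + ρ), c * coeffNorm d P ≤ |P.eval x| := by
  set v : Fin (d + 1) → ℝ := fun i => a / 2 * (i / (d + 1)) with hv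
  have hinj : Function.Injective v := fun i j hij => by
    have : a / 2 ≠ 0 := by positivity
    have hd : (d : ℝ) + 1 ≠ 0 := by positivity
    simp only [hv, mul_eq_mul_left_iff, this, or_false, div_left_inj' hd, Nat.cast_inj] at hij
    exact Fin.ext hij
  obtain ⟨c, hc, h⟩ := exists_coeffNorm_le_abs_eval d hinj
  refine ⟨c / 2, by positivity, min (a / 2) (c / (2 * (d + 1))), by positivity,
    (min_le_left _ _).trans (by linarith), fun P hP => ?_⟩
  obtain ⟨i, hi⟩ := h P hP
  set ρ := min (a / 2) (c / (2 * (d + 1))) with hρ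
  have hρ1 : ρ ≤ a / 2 := min_le_left _ _
  have hρ2 : ρ ≤ c / (2 * (d + 1)) := min_le_right _ _
  have hvi : 0 ≤ v i := by positivity
  have hvi' : v i ≤ a / 2 := by
    refine mul_le_of_le_one_right (by positivity) (div_le_one_of_le₀ ?_ (by positivity))
    exact_mod_cast i.2.le
  refine ⟨v i, hvi, by linarith, fun x hx => ?_⟩
  have hlip := abs_eval_sub_eval_le hP (x := v i) (y := x)
    (by rw [abs_of_nonneg hvi]; linarith) (by rw [abs_le]; constructor <;> linarith [hx.1, hx.2])
  have hN := coeffNorm_nonneg d P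
  have h1 : (d : ℝ) * |v i - x| ≤ c / 2 := by
    have : |v i - x| ≤ ρ := by rw [abs_le]; constructor <;> linarith [hx.1, hx.2]
    calc (d : ℝ) * |v i - x| ≤ (d + 1) * (c / (2 * (d + 1))) := by
          gcongr
          · linarith
          · exact this.trans hρ2
      _ = c / 2 := by field_simp
  have h2 := mul_le_mul_of_nonneg_right h1 hN
  have h3 := abs_sub_abs_le_abs_sub (P.eval (v i)) (P.eval x)
  linarith

/-- Every polynomial of degree `≤ k` is a combination of the powers `(X - uᵢ)ᵏ` with coefficients
bounded in terms of the separation of the nodes. -/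
theorem exists_powSum_eq (k : ℕ) (A : ℝ) {γ : ℝ} (hγ : 0 < γ) :
    ∃ K > 0, ∀ u : Fin (k + 1) → ℝ, (∀ i, |u i| ≤ A) → (∀ i j, i < j → u i + γ ≤ u j) →
      ∀ R : ℝ[X], R.natDegree ≤ k → ∃ μ : ℝ →₀ ℝ, (∀ w ∈ μ.support, ∃ i, w = u i) ∧
        powSum k μ = R ∧ mass μ ≤ K * coeffNorm k R := by
  set S : Set (Fin (k + 1) → ℝ) :=
    (Set.univ.pi fun _ => Set.Icc (-A) A) ∩ ⋂ i, ⋂ j, {u | i < j → u i + γ ≤ u j} with hS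
  have hSc : IsCompact S := by
    refine (isCompact_univ_pi fun _ => isCompact_Icc).inter_right ?_
    refine isClosed_iInter fun i => isClosed_iInter fun j => ?_
    by_cases hij : i < j
    · simp only [hij, forall_true_left]
      exact isClosed_le (by fun_prop) (by fun_prop)
    · simp [hij]
  have hdet : ∀ u ∈ S, (Matrix.vandermonde u).det ≠ 0 := fun u hu => by
    refine Matrix.det_vandermonde_ne_zero_iff.2 (StrictMono.injective fun i j hij => ?_)
    have := Set.mem_iInter.1 (Set.mem_iInter.1 hu.2 i) j hij
    linarith
  set g : (Fin (k + 1) → ℝ) → Fin (k + 1) → Fin (k + 1) → ℝ := fun u i j =>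
    ((Matrix.vandermonde u).det)⁻¹ * (Matrix.vandermonde u).adjugate i j with hg
  have hV : Continuous fun u : Fin (k + 1) → ℝ => Matrix.vandermonde u :=
    continuous_matrix fun i j => by
      simp only [Matrix.vandermonde_apply]
      fun_prop
  have hgc : ContinuousOn g S := by
    refine continuousOn_pi.2 fun i => continuousOn_pi.2 fun j => ?_
    refine ContinuousOn.mul (hV.matrix_det.continuousOn.inv₀ hdet) ?_
    exact (hV.matrix_adjugate.matrix_elem i j).continuousOn
  obtain ⟨B, hB⟩ := hSc.exists_bound_of_continuousOn hgc
  refine ⟨(k + 1) * ((k + 1) * |B|) + 1, by positivity, fun u huA huγ R hR => ?_⟩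
  have hu : u ∈ S :=
    ⟨fun i _ => abs_le.1 (huA i), Set.mem_iInter.2 fun i => Set.mem_iInter.2 fun j => huγ i j⟩
  set N := coeffNorm k R with hN
  have hNn : 0 ≤ N := coeffNorm_nonneg k R
  set m : Fin (k + 1) → ℝ := fun l =>
    (-1) ^ (l : ℕ) * R.coeff (k - l) / (k.choose (k - l) : ℝ) with hm
  set c : Fin (k + 1) → ℝ := Matrix.vecMul m (Matrix.vandermonde u)⁻¹ with hc
  have hmul : Matrix.vecMul c (Matrix.vandermonde u) = m := by
    rw [hc, Matrix.vecMul_vecMul, Matrix.nonsing_inv_mul _ (hdet u hu).isUnit, Matrix.vecMul_one]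
  have hmN : ∀ l, |m l| ≤ N := fun l => by
    have h1 : (1 : ℝ) ≤ k.choose (k - l) := by
      exact_mod_cast Nat.choose_pos (Nat.sub_le _ _)
    rw [hm]
    simp only [abs_div, abs_mul, abs_pow, abs_neg, abs_one, one_pow, one_mul, Nat.abs_cast]
    exact (div_le_self (abs_nonneg _) h1).trans (abs_coeff_le_coeffNorm R (Nat.sub_le _ _))
  have hci : ∀ i, |c i| ≤ (k + 1) * |B| * N := fun i => by
    have hinv : ∀ l, |(Matrix.vandermonde u)⁻¹ l i| ≤ |B| := fun l => by
      have h1 := (norm_le_pi_norm (g u l) i).trans ((norm_le_pi_norm (g u) l).trans (hB u hu))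
      refine le_trans (le_of_eq ?_) (h1.trans (le_abs_self B))
      rw [Matrix.inv_def, Ring.inverse_eq_inv', Real.norm_eq_abs]
      rfl
    rw [hc, Matrix.vecMul, dotProduct]
    refine (Finset.abs_sum_le_sum_abs _ _).trans ?_
    refine (Finset.sum_le_card_nsmul _ _ (N * |B|) fun l _ => ?_).trans ?_
    · rw [abs_mul]
      exact mul_le_mul (hmN l) (hinv l) (abs_nonneg _) hNn
    · simp only [Finset.card_univ, Fintype.card_fin, nsmul_eq_mul]
      push_cast
      linarith
  classical
  refine ⟨∑ i, Finsupp.single (u i) (c i), fun w hw => ?_, ?_, ?_⟩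
  · obtain ⟨i, _, hi⟩ := Finset.mem_biUnion.1 (Finsupp.support_finsetSum hw)
    exact ⟨i, Finset.mem_singleton.1 (Finsupp.support_single_subset hi)⟩
  · rw [map_sum]
    ext j
    simp only [powSum, Finsupp.linearCombination_single, finsetSum_coeff, coeff_smul,
      sub_eq_add_neg X, ← C_neg, coeff_X_add_C_pow, smul_eq_mul]
    by_cases hj : j ≤ k
    · have h1 := congrFun hmul ⟨k - j, by lia⟩
      simp only [Matrix.vecMul, dotProduct, Matrix.vandermonde_apply, hm, Nat.sub_sub_self hj] at h1
      have h2 : (k.choose j : ℝ) ≠ 0 := by exact_mod_cast (Nat.choose_pos hj).ne'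
      calc ∑ i, c i * ((-u i) ^ (k - j) * (k.choose j : ℝ))
          = (-1) ^ (k - j) * k.choose j * ∑ i, c i * u i ^ (k - j) := by
            rw [Finset.mul_sum]
            refine Finset.sum_congr rfl fun i _ => ?_
            rw [neg_pow (u i)]; ring
        _ = R.coeff j := by
            rw [h1]
            have h3 : ((-1 : ℝ) ^ (k - j)) * (-1) ^ (k - j) = 1 := by
              rw [← mul_pow]; simp
            field_simp
            linear_combination R.coeff j * h3
    · rw [coeff_eq_zero_of_natDegree_lt (by lia)]
      simp [Nat.choose_eq_zero_of_lt (not_le.1 hj)]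
  · have hsum : ∀ s : Finset (Fin (k + 1)),
        mass (∑ i ∈ s, Finsupp.single (u i) (c i)) ≤ ∑ i ∈ s, |c i| := fun s => by
      induction s using Finset.induction_on with
      | empty => simp [mass]
      | insert a s ha ih =>
        rw [Finset.sum_insert ha, Finset.sum_insert ha]
        refine (mass_add_le _ _).trans ?_
        rw [mass_single]
        gcongr
    refine (hsum _).trans ((Finset.sum_le_card_nsmul _ _ _ fun i _ => hci i).trans ?_)
    simp only [Finset.card_univ, Fintype.card_fin, nsmul_eq_mul]
    push_cast
    nlinarith

/-- Every interval of length `ε` contained in `[a, b]` meets `W`. -/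
def Meshed (W : Set ℝ) (ε a b : ℝ) : Prop :=
  ∀ x, a ≤ x → x + ε ≤ b → ∃ w ∈ W, w ∈ Set.Icc x (x + ε)

theorem Meshed.mono {W : Set ℝ} {ε ε' a b a' b' : ℝ} (h : Meshed W ε a b) (hε : ε ≤ ε')
    (ha : a ≤ a') (hb : b' ≤ b) : Meshed W ε' a' b' := fun x hx hx' => by
  obtain ⟨w, hw, h1, h2⟩ := h x (ha.trans hx) (by linarith)
  exact ⟨w, hw, h1, by linarith⟩

theorem Meshed.preimage_mul {W : Set ℝ} {ε a b : ℝ} (hε : 0 < ε) (h : Meshed W ε (ε * a) (ε * b)) :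
    Meshed ((fun t => 0 + ε * t) ⁻¹' W) 1 a b := fun x hx hx' => by
  obtain ⟨w, hw, h1, h2⟩ := h (ε * x) (by gcongr) (by nlinarith)
  refine ⟨w / ε, ?_, ?_, ?_⟩
  · simpa [mul_div_cancel₀ _ hε.ne'] using hw
  · rw [le_div_iff₀ hε]; linarith
  · rw [div_le_iff₀ hε]; linarith

theorem Meshed.exists_nodes {W : Set ℝ} {ε a b : ℝ} (hε : 0 ≤ ε) (h : Meshed W ε a b) (k : ℕ)
    (hk : a + (2 * k + 1) * ε ≤ b) :
    ∃ u : Fin (k + 1) → ℝ, (∀ i, u i ∈ W ∧ u i ∈ Set.Icc a (a + (2 * k + 1) * ε)) ∧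
      ∀ i j, i < j → u i + ε ≤ u j := by
  have hex : ∀ i : Fin (k + 1), ∃ w ∈ W, w ∈ Set.Icc (a + 2 * i * ε) (a + 2 * i * ε + ε) :=
    fun i => by
      have hi : (i : ℝ) ≤ k := by exact_mod_cast Nat.lt_succ_iff.1 i.2
      have hi0 : (0 : ℝ) ≤ i := by positivity
      exact h _ (by nlinarith) (by nlinarith)
  choose u huW hu using hex
  refine ⟨u, fun i => ⟨huW i, ?_, ?_⟩, fun i j hij => ?_⟩
  · have hi0 : (0 : ℝ) ≤ i := by positivity
    nlinarith [(hu i).1]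
  · have hi : (i : ℝ) ≤ k := by exact_mod_cast Nat.lt_succ_iff.1 i.2
    nlinarith [(hu i).2]
  · have hij' : (i : ℝ) + 1 ≤ j := by exact_mod_cast hij
    nlinarith [(hu i).2, (hu j).1]

/-- Monotone splines of degree `r + 1` that increase from `0` to `1`. -/
theorem exists_transition (r : ℕ) : ∃ L > 0, ∃ K > 0, ∀ (W : Set ℝ) (a : ℝ),
    Meshed W 1 a (a + L) → ∃ μ : ℝ →₀ ℝ, (∀ w ∈ μ.support, w ∈ W ∧ w ∈ Set.Icc a (a + L)) ∧
      mass μ ≤ K ∧ Monotone (spl (r + 1) μ) ∧ ∀ x, a + L ≤ x → spl (r + 1) μ x = 1 := by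
  induction r with
  | zero =>
    refine ⟨3, by norm_num, 2, by norm_num, fun W a hW => ?_⟩
    obtain ⟨v, hvW, hv1, hv2⟩ := hW a le_rfl (by linarith)
    obtain ⟨w, hwW, hw1, hw2⟩ := hW (a + 2) (by linarith) (by linarith)
    have hvw : 0 < w - v := by linarith
    set μ : ℝ →₀ ℝ := Finsupp.single v (1 / (w - v)) - Finsupp.single w (1 / (w - v)) with hμ
    have hspl : ∀ x, spl (0 + 1) μ x = (max (x - v) 0 - max (x - w) 0) / (w - v) := fun x => by
      rw [hμ, map_sub]
      simp only [spl, zero_add, pow_one, Finsupp.linearCombination_single, Pi.sub_apply,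
        Pi.smul_apply, smul_eq_mul]
      ring
    refine ⟨μ, fun y hy => ?_, ?_, fun x y hxy => ?_, fun x hx => ?_⟩
    · have hy' := Finsupp.support_sub hy
      rcases Finset.mem_union.1 hy' with h | h
      · rw [Finset.mem_singleton.1 (Finsupp.support_single_subset h)]
        exact ⟨hvW, hv1, by linarith⟩
      · rw [Finset.mem_singleton.1 (Finsupp.support_single_subset h)]
        exact ⟨hwW, by linarith, by linarith⟩
    · refine (mass_sub_le _ _).trans ?_
      rw [mass_single, mass_single, abs_of_pos (by positivity)]
      have : 1 / (w - v) ≤ 1 := by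
        rw [div_le_one hvw]; linarith
      linarith
    · rw [hspl, hspl]
      gcongr 1
      rcases max_cases (x - v) 0 with h1 | h1 <;> rcases max_cases (x - w) 0 with h2 | h2 <;>
      rcases max_cases (y - v) 0 with h3 | h3 <;> rcases max_cases (y - w) 0 with h4 | h4 <;>
      linarith
    · rw [hspl, max_eq_left (by linarith), max_eq_left (by linarith), div_eq_one_iff_eq hvw.ne']
      ring
  | succ r ih =>
    obtain ⟨L, hL, K, hK, ih⟩ := ih
    refine ⟨2 * L + 1, by positivity, 2 * K, by positivity, fun W a hW => ?_⟩
    obtain ⟨μ, hμW, hμK, hμm, hμ1⟩ := ih W a (hW.mono le_rfl le_rfl (by linarith))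
    obtain ⟨ν, hνW, hνK, hνm, hν1⟩ := ih W (a + L + 1)
      (hW.mono le_rfl (by linarith) (by linarith))
    have hμ0 : ∀ x, x ≤ a → spl (r + 1) μ x = 0 := fun x hx =>
      spl_eq_zero (by lia) fun w hw => hx.trans (hμW w hw).2.1
    have hν0 : ∀ x, x ≤ a + L + 1 → spl (r + 1) ν x = 0 := fun x hx =>
      spl_eq_zero (by lia) fun w hw => hx.trans (hνW w hw).2.1
    set F := spl (r + 2) (μ - ν) with hF
    have hd : ∀ x, HasDerivAt F ((r + 2) * (spl (r + 1) μ x - spl (r + 1) ν x)) x := fun x => by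
      have := hasDerivAt_spl r (μ - ν) x
      rwa [map_sub (spl (r + 1))] at this
    have hdiff : Differentiable ℝ F := fun x => (hd x).differentiableAt
    have hmono : Monotone F := by
      refine monotone_of_deriv_nonneg hdiff fun x => ?_
      rw [(hd x).deriv]
      refine mul_nonneg (by positivity) ?_
      rcases le_total x (a + L) with h | h
      · rw [hν0 x (by linarith), sub_zero, ← hμ0 (min x a) (min_le_right _ _)]
        exact hμm (min_le_left _ _)
      · rw [hμ1 x h, sub_nonneg, ← hν1 (max x (a + L + 1 + L)) (le_max_right _ _)]
        exact hνm (le_max_left _ _)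
    set b := a + (2 * L + 1) with hb
    have hconst : ∀ x, b ≤ x → F x = F b := fun x hx => by
      refine le_antisymm ?_ (hmono hx)
      refine antitoneOn_of_deriv_nonpos (convex_Ici b) hdiff.continuous.continuousOn
        hdiff.differentiableOn (fun y hy => ?_) (Set.mem_Ici.2 le_rfl) (Set.mem_Ici.2 hx) hx
      rw [interior_Ici, Set.mem_Ioi] at hy
      rw [(hd y).deriv, hμ1 y (by linarith), hν1 y (by linarith), sub_self, mul_zero]
    have hF1 : 1 ≤ F b := by
      have h0 : 0 ≤ F (a + L) := by
        rw [← spl_eq_zero (k := r + 2) (by lia) (μ := μ - ν) (x := a)]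
        · exact hmono (by linarith)
        · intro w hw
          rcases Finset.mem_union.1 (Finsupp.support_sub hw) with h | h
          · exact (hμW w h).2.1
          · linarith [(hνW w h).2.1]
      have h1 : 1 * ((a + L + 1) - (a + L)) ≤ F (a + L + 1) - F (a + L) := by
        refine (convex_Icc (a + L) (a + L + 1)).mul_sub_le_image_sub_of_le_deriv
          hdiff.continuous.continuousOn hdiff.differentiableOn (fun y hy => ?_)
          _ (by constructor <;> linarith) _ (by constructor <;> linarith) (by linarith)
        rw [interior_Icc] at hy
        rw [(hd y).deriv, hμ1 y hy.1.le, hν0 y hy.2.le]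
        have : (0 : ℝ) ≤ r := by positivity
        linarith
      have h2 : F (a + L + 1) ≤ F b := hmono (by linarith)
      linarith
    have hFpos : 0 < F b := by linarith
    refine ⟨(1 / F b) • (μ - ν), fun w hw => ?_, ?_, fun x y hxy => ?_, fun x hx => ?_⟩
    · rcases Finset.mem_union.1 (Finsupp.support_sub (Finsupp.support_smul hw)) with h | h
      · exact ⟨(hμW w h).1, (hμW w h).2.1, by linarith [(hμW w h).2.2]⟩
      · exact ⟨(hνW w h).1, by linarith [(hνW w h).2.1], by linarith [(hνW w h).2.2]⟩
    · rw [mass_smul, abs_of_pos (by positivity)]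
      have h1 : 1 / F b ≤ 1 := by rwa [div_le_one hFpos]
      calc 1 / F b * mass (μ - ν) ≤ 1 * mass (μ - ν) :=
            mul_le_mul_of_nonneg_right h1 (mass_nonneg _)
        _ ≤ 2 * K := by linarith [mass_sub_le μ ν]
    · rw [map_smul]
      simp only [Pi.smul_apply, smul_eq_mul]
      exact mul_le_mul_of_nonneg_left (hmono hxy) (by positivity)
    · rw [map_smul, Pi.smul_apply, smul_eq_mul, ← hF, hconst x hx, one_div_mul_cancel hFpos.ne']

theorem powSum_eq_of_spl_eq {k : ℕ} {μ : ℝ →₀ ℝ} {P : ℝ[X]} {b : ℝ}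
    (hμ : ∀ w ∈ μ.support, w ≤ b) (h : ∀ x, b ≤ x → spl k μ x = P.eval x) : powSum k μ = P := by
  refine eq_of_infinite_eval_eq _ _ ((Set.Ici_infinite b).mono fun x hx => ?_)
  rw [Set.mem_ofPred_eq, ← h x hx, spl_eq_eval fun w hw => (hμ w hw).trans hx]

theorem abs_eval_le_pow_mul {d : ℕ} {P : ℝ[X]} (hP : P.natDegree ≤ d) {x A : ℝ} (hA : 1 ≤ A)
    (hx : |x| ≤ A) : |P.eval x| ≤ A ^ d * coeffNorm d P := by
  rw [eval_eq_sum_range' (Nat.lt_succ_of_le hP), coeffNorm, Finset.mul_sum]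
  refine (Finset.abs_sum_le_sum_abs _ _).trans (Finset.sum_le_sum fun i hi => ?_)
  rw [abs_mul, abs_pow, mul_comm]
  refine mul_le_mul_of_nonneg_right ?_ (abs_nonneg _)
  exact (pow_le_pow_left₀ (abs_nonneg _) hx _).trans
    (pow_le_pow_right₀ hA (Nat.lt_succ_iff.1 (Finset.mem_range.1 hi)))

/-- One-sided approximation of the truncation of a polynomial by splines. -/
theorem exists_spl_ge (r : ℕ) (hr : 1 ≤ r) : ∃ L > 0, ∃ K > 0, ∀ W : Set ℝ, Meshed W 1 (-L) L →
    ∀ D : ℝ[X], D.natDegree ≤ r → ∃ μ : ℝ →₀ ℝ,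
      (∀ w ∈ μ.support, w ∈ W ∧ w ∈ Set.Icc (-L) L) ∧ mass μ ≤ K * coeffNorm r D ∧
      powSum r μ = D ∧ (∀ x, x ≤ 0 → 0 ≤ spl r μ x) ∧ ∀ x, 0 ≤ x → D.eval x ≤ spl r μ x := by
  obtain ⟨s, rfl⟩ : ∃ s, r = s + 1 := ⟨r - 1, by lia⟩
  set r := s + 1
  obtain ⟨L, hL, K, hK, hT⟩ := exists_transition s
  set A : ℝ := 2 * r + 1 with hA
  have hA1 : 1 ≤ A := by rw [hA]; linarith [Nat.cast_nonneg (α := ℝ) r]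
  obtain ⟨M, hM, hV⟩ := exists_powSum_eq r A one_pos
  refine ⟨A + L, by positivity, M + (M + 1) * A ^ r * (2 * K), by positivity, fun W hW D hD => ?_⟩
  obtain ⟨u, hu, hsep⟩ := (hW.mono le_rfl (a' := 0) (b' := A) (by linarith)
    (by linarith)).exists_nodes zero_le_one r (by linarith)
  have hu' : ∀ i, u i ∈ Set.Icc 0 A := fun i => by simpa [hA] using (hu i).2
  obtain ⟨μ, hμu, hμD, hμM⟩ := hV u (fun i => abs_le.2 ⟨by linarith [(hu' i).1], (hu' i).2⟩)
    hsep D hD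
  have hμW : ∀ w ∈ μ.support, w ∈ W ∧ w ∈ Set.Icc 0 A := fun w hw => by
    obtain ⟨i, rfl⟩ := hμu w hw
    exact ⟨(hu i).1, hu' i⟩
  obtain ⟨τ, hτW, hτK, hτm, hτ1⟩ := hT W (-L) (hW.mono le_rfl (by linarith) (by linarith))
  obtain ⟨σ, hσW, hσK, hσm, hσ1⟩ := hT W A (hW.mono le_rfl (by linarith) (by linarith))
  have hτ0 : ∀ x, 0 ≤ spl r τ x := fun x => by
    rw [← spl_eq_zero (k := r) hr (μ := τ) (x := min x (-L))]
    · exact hτm (min_le_left _ _)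
    · exact fun w hw => (min_le_right _ _).trans (hτW w hw).2.1
  have hσ0 : ∀ x, x ≤ A → spl r σ x = 0 := fun x hx =>
    spl_eq_zero hr fun w hw => hx.trans (hσW w hw).2.1
  have hσle : ∀ x, spl r σ x ≤ 1 := fun x => by
    rw [← hσ1 (max x (A + L)) (le_max_right _ _)]
    exact hσm (le_max_left _ _)
  have hτ1' : ∀ x, 0 ≤ x → spl r τ x = 1 := fun x hx => hτ1 x (by linarith)
  set N := coeffNorm r D with hN
  have hN0 : 0 ≤ N := coeffNorm_nonneg _ _
  set B := (M + 1) * A ^ r * N with hB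
  have hB0 : 0 ≤ B := by positivity
  have hspl : ∀ x, spl r (μ + B • (τ - σ)) x = spl r μ x + B * (spl r τ x - spl r σ x) :=
    fun x => by simp [map_add, map_sub, map_smul]
  have hp : ∀ ξ : ℝ →₀ ℝ, ∀ b, (∀ w ∈ ξ.support, w ≤ b) → (∀ x, b ≤ x → spl r ξ x = 1) →
      powSum r ξ = 1 := fun ξ b h1 h2 => powSum_eq_of_spl_eq h1 (by simpa using h2)
  refine ⟨μ + B • (τ - σ), fun w hw => ?_, ?_, ?_, fun x hx => ?_, fun x hx => ?_⟩
  · rcases Finset.mem_union.1 (Finsupp.support_add hw) with h | h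
    · have := hμW w h
      exact ⟨this.1, by linarith [this.2.1], by linarith [this.2.2]⟩
    · rcases Finset.mem_union.1 (Finsupp.support_sub (Finsupp.support_smul h)) with h | h
      · exact ⟨(hτW w h).1, by linarith [(hτW w h).2.1], by linarith [(hτW w h).2.2]⟩
      · exact ⟨(hσW w h).1, by linarith [(hσW w h).2.1], by linarith [(hσW w h).2.2]⟩
  · refine (mass_add_le _ _).trans ?_
    rw [mass_smul, abs_of_nonneg hB0]
    have h1 : B * mass (τ - σ) ≤ B * (2 * K) := by
      gcongr
      linarith [mass_sub_le τ σ]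
    calc mass μ + B * mass (τ - σ) ≤ M * N + B * (2 * K) := add_le_add hμM h1
      _ = _ := by rw [hB]; ring
  · rw [map_add, map_smul, map_sub, hμD, hp τ 0 (fun w hw => by linarith [(hτW w hw).2.2]) hτ1',
      hp σ (A + L) (fun w hw => (hσW w hw).2.2) hσ1, sub_self, smul_zero, add_zero]
  · rw [hspl, spl_eq_zero hr fun w hw => hx.trans (hμW w hw).2.1, hσ0 x (by linarith)]
    have := mul_nonneg hB0 (hτ0 x)
    linarith
  · rw [hspl, hτ1' x hx]
    rcases le_total x A with h | h
    · rw [hσ0 x h]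
      have h1 := abs_spl_le r (μ := μ) (x := x) (R := A) (by linarith)
        fun w hw => by linarith [(hμW w hw).2.1]
      have h2 := abs_eval_le_pow_mul hD hA1 (x := x) (abs_le.2 ⟨by linarith, h⟩)
      have h3 : A ^ r * mass μ ≤ A ^ r * (M * N) := by gcongr
      have h4 : B = A ^ r * (M * N) + A ^ r * N := by rw [hB]; ring
      linarith [neg_abs_le (spl r μ x), le_abs_self (D.eval x)]
    · rw [spl_eq_eval fun w hw => (hμW w hw).2.2.trans h, hμD]
      have := mul_nonneg hB0 (sub_nonneg.2 (hσle x))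
      linarith

theorem natDegree_iterate_derivative_le {q r : ℕ} {P : ℝ[X]} (hP : P.natDegree ≤ q + r) :
    (derivative^[q] P).natDegree ≤ r :=
  (natDegree_iterate_derivative P q).trans (by lia)

theorem coeffNorm_comp_neg_X (d : ℕ) (P : ℝ[X]) : coeffNorm d (P.comp (-X)) = coeffNorm d P := by
  refine Finset.sum_congr rfl fun i _ => ?_
  have : (-X : ℝ[X]) = C (-1) * X := by simp
  rw [this, comp_C_mul_X_coeff, abs_mul, abs_pow, abs_neg, abs_one, one_pow, mul_one]

theorem coeffNorm_iterate_derivative_le (q r : ℕ) (P : ℝ[X]) :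
    coeffNorm r (derivative^[q] P)
      ≤ (r + 1) * ((q + r).descFactorial q * coeffNorm (q + r) P) := by
  refine coeffNorm_le_of_coeff_le fun i hi => ?_
  rw [coeff_iterate_derivative, nsmul_eq_mul, abs_mul, Nat.abs_cast]
  refine mul_le_mul ?_ (abs_coeff_le_coeffNorm _ (by lia)) (abs_nonneg _) (by positivity)
  exact_mod_cast Nat.descFactorial_le q (by lia)

theorem abs_coeff_powSum_le (k : ℕ) (μ : ℝ →₀ ℝ) {R : ℝ} (hμ : ∀ w ∈ μ.support, |w| ≤ R) (i : ℕ) :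
    |(powSum k μ).coeff i| ≤ k.choose i * R ^ (k - i) * mass μ := by
  rw [powSum_apply, finsetSum_coeff, mass, Finsupp.mul_sum]
  refine (Finset.abs_sum_le_sum_abs _ _).trans (Finset.sum_le_sum fun w hw => ?_)
  rw [coeff_C_mul, sub_eq_add_neg X, ← C_neg, coeff_X_add_C_pow, abs_mul, abs_mul, abs_pow, abs_neg,
    Nat.abs_cast, mul_comm, mul_comm (|w| ^ _)]
  exact mul_le_mul_of_nonneg_right (mul_le_mul_of_nonneg_left
    (pow_le_pow_left₀ (abs_nonneg _) (hμ w hw) _) (by positivity)) (abs_nonneg _)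

theorem coeffNorm_smul (d : ℕ) (a : ℝ) (P : ℝ[X]) :
    coeffNorm d (a • P) = |a| * coeffNorm d P := by
  rw [coeffNorm, coeffNorm, Finset.mul_sum]
  exact Finset.sum_congr rfl fun i _ => by rw [coeff_smul, smul_eq_mul, abs_mul]

/-- One-sided approximation of the truncation of a polynomial by splines, at the scale `η`. -/
theorem exists_spl_ge_of_scale (r : ℕ) (hr : 1 ≤ r) : ∃ L > 0, ∃ K > 0, ∀ η : ℝ, 0 < η → η ≤ 1 →
    ∀ W : Set ℝ, Meshed W η (-(η * L)) (η * L) → ∀ D : ℝ[X], D.natDegree ≤ r → ∃ μ : ℝ →₀ ℝ,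
      (∀ w ∈ μ.support, w ∈ W ∧ |w| ≤ η * L) ∧ mass μ ≤ K * (η ^ r)⁻¹ * coeffNorm r D ∧
      powSum r μ = D ∧ (∀ x, x ≤ 0 → 0 ≤ spl r μ x) ∧ ∀ x, 0 ≤ x → D.eval x ≤ spl r μ x := by
  obtain ⟨L, hL, K, hK, hS⟩ := exists_spl_ge r hr
  refine ⟨L, hL, K, hK, fun η hη0 hη1 W hW D hDd => ?_⟩
  set R : ℝ[X] := C (η ^ r)⁻¹ * D.comp (C η * X) with hR
  have hRd : R.natDegree ≤ r := by
    refine (natDegree_C_mul_le _ _).trans ?_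
    rw [natDegree_comp, natDegree_C_mul_X _ hη0.ne', mul_one]
    exact hDd
  have hRN : coeffNorm r R ≤ (η ^ r)⁻¹ * coeffNorm r D := by
    rw [coeffNorm, coeffNorm, Finset.mul_sum]
    refine Finset.sum_le_sum fun i _ => ?_
    rw [hR, coeff_C_mul, comp_C_mul_X_coeff, abs_mul, abs_mul, abs_of_pos (pow_pos hη0 i),
      abs_of_pos (by positivity : 0 < (η ^ r)⁻¹)]
    gcongr
    exact mul_le_of_le_one_right (abs_nonneg _) (pow_le_one₀ hη0.le hη1)
  have hRe : ∀ t, η ^ r * R.eval t = D.eval (η * t) := fun t => by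
    rw [hR, eval_mul, eval_C, eval_comp, eval_mul, eval_C, eval_X,
      mul_inv_cancel_left₀ (by positivity)]
  obtain ⟨μ, hμW, hμM, hμR, hμn, hμp⟩ := hS _ (Meshed.preimage_mul (a := -L) (b := L) hη0
    (hW.mono le_rfl (by linarith) le_rfl)) R hRd
  have hscale : ∀ x, ∃ t, x = 0 + η * t := fun x => ⟨x / η, by field_simp; ring⟩
  refine ⟨affineMap 0 η μ, fun w hw => ?_, ?_, ?_, fun x hx => ?_, fun x hx => ?_⟩
  · obtain ⟨t, ht, rfl⟩ := exists_of_mem_support_affineMap hw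
    refine ⟨(hμW t ht).1, ?_⟩
    rw [zero_add, abs_mul, abs_of_pos hη0]
    gcongr
    exact abs_le.2 (hμW t ht).2
  · rw [mass_affineMap hη0.ne']
    calc mass μ ≤ K * coeffNorm r R := hμM
      _ ≤ K * ((η ^ r)⁻¹ * coeffNorm r D) := by gcongr
      _ = _ := by ring
  · refine Polynomial.funext fun x => ?_
    obtain ⟨t, rfl⟩ := hscale x
    rw [eval_powSum_affineMap, hμR, hRe, zero_add]
  · obtain ⟨t, rfl⟩ := hscale x
    rw [spl_affineMap _ hη0.le]
    refine mul_nonneg (by positivity) (hμn t ?_)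
    by_contra! h
    nlinarith [mul_pos hη0 h]
  · obtain ⟨t, rfl⟩ := hscale x
    rw [spl_affineMap _ hη0.le, zero_add, ← hRe]
    refine mul_le_mul_of_nonneg_left (hμp t ?_) (by positivity)
    by_contra! h
    nlinarith [mul_pos hη0 (neg_pos.2 h)]

set_option maxHeartbeats 1000000 in
/-- A jump of a `q`-monotone piecewise polynomial at the origin can be smoothed by splines with
knots in a sufficiently dense set, with control of the size of the correction. -/
theorem exists_local_correction (q r : ℕ) (hr : 1 ≤ r) : ∃ δ > 0, ∃ K > 0, ∀ W : Set ℝ,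
    Meshed W δ (-1 / 2) (1 / 2) → ∀ P₁ P₂ : ℝ[X], P₁.natDegree ≤ q + r → P₂.natDegree ≤ q + r →
    (∀ i < q, (P₂ - P₁).coeff i = 0) →
    (∀ x ∈ Set.Icc (-1 / 2) 0, 0 ≤ (derivative^[q] P₁).eval x) →
    (∀ x ∈ Set.Icc 0 (1 / 2), 0 ≤ (derivative^[q] P₂).eval x) →
    ∃ μ : ℝ →₀ ℝ, (∀ w ∈ μ.support, w ∈ W ∧ w ∈ Set.Icc (-1 / 2) (1 / 2)) ∧
      powSum (q + r) μ = P₂ - P₁ ∧ mass μ ≤ K * coeffNorm (q + r) (P₂ - P₁) ∧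
      ∀ x ∈ Set.Icc (-1 / 2) (1 / 2),
        0 ≤ (derivative^[q] P₁).eval x + (q + r).descFactorial q * spl r μ x := by
  obtain ⟨c, hc, ρ, hρ, hρ1, hI⟩ := exists_Icc_coeffNorm_le r (a := 1 / 2) (by norm_num)
    (by norm_num)
  obtain ⟨L, hL, K₁, hK₁, hS⟩ := exists_spl_ge_of_scale r hr
  set k := q + r with hk
  set ρ' : ℝ := ρ / (2 * k + 1) with hρ'
  have hρ'pos : 0 < ρ' := by positivity
  obtain ⟨K₃, hK₃, hV⟩ := exists_powSum_eq k 1 hρ'pos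
  set κ : ℝ := (k.descFactorial q : ℝ) with hκ
  have hκ0 : 0 < κ := by
    exact Nat.cast_pos.2 (Nat.descFactorial_pos.2 (Nat.le_add_right q r))
  set K₂ : ℝ := (k + 1) * (2 ^ k * L ^ (r + 1) * (K₁ * κ⁻¹)) with hK₂
  have hK₂0 : 0 < K₂ := by positivity
  set η : ℝ := min (min 1 (1 / (2 * L))) (c / (2 * (κ * K₃ * K₂))) with hη
  have hη0 : 0 < η := by positivity
  have hηL : η * L ≤ 1 / 2 := by
    calc η * L ≤ 1 / (2 * L) * L := by gcongr; exact (min_le_left _ _).trans (min_le_right _ _)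
      _ = 1 / 2 := by field_simp
  have hηc : κ * (K₃ * (K₂ * η)) ≤ c / 2 := by
    calc κ * (K₃ * (K₂ * η)) ≤ κ * (K₃ * (K₂ * (c / (2 * (κ * K₃ * K₂))))) := by
          gcongr; exact min_le_right _ _
      _ = c / 2 := by field_simp
  refine ⟨min η ρ', by positivity,
    (K₁ * κ⁻¹ * (η ^ r)⁻¹ + K₃ * (K₂ * η)) * ((r + 1) * κ), by positivity, ?_⟩
  intro W hW P₁ P₂ hP₁ hP₂ hlow hpos₁ hpos₂
  set p₁ := derivative^[q] P₁ with hp₁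
  set p₂ := derivative^[q] P₂ with hp₂
  set Q := P₂ - P₁ with hQ
  have hQd : Q.natDegree ≤ k := (natDegree_sub_le _ _).trans (max_le hP₂ hP₁)
  set D := derivative^[q] Q with hD
  have hDp : D = p₂ - p₁ := by rw [hD, hQ, iterate_derivative_sub]
  have hp₁d : p₁.natDegree ≤ r := natDegree_iterate_derivative_le hP₁
  have hp₂d : p₂.natDegree ≤ r := natDegree_iterate_derivative_le hP₂
  have hDd : D.natDegree ≤ r := natDegree_iterate_derivative_le hQd
  set N := coeffNorm r D with hN
  have hN0 : 0 ≤ N := coeffNorm_nonneg _ _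
  have hNQ : N ≤ (r + 1) * κ * coeffNorm k Q := by
    rw [mul_assoc]; exact coeffNorm_iterate_derivative_le q r Q
  -- an interval on which the derivative of the piecewise polynomial is large
  obtain ⟨y₀, hy0, hy1, hbig⟩ : ∃ y₀, -1 / 2 ≤ y₀ ∧ y₀ + ρ ≤ 1 / 2 ∧
      ((0 ≤ y₀ ∧ ∀ x ∈ Set.Icc y₀ (y₀ + ρ), c / 2 * N ≤ p₂.eval x) ∨
        (y₀ + ρ ≤ 0 ∧ ∀ x ∈ Set.Icc y₀ (y₀ + ρ), c / 2 * N ≤ p₁.eval x)) := by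
    have hNle : N ≤ coeffNorm r p₂ + coeffNorm r p₁ := by
      rw [hN, hDp]; exact coeffNorm_sub_le _ _ _
    rcases le_total (coeffNorm r p₁) (coeffNorm r p₂) with h | h
    · obtain ⟨x₀, h1, h2, h3⟩ := hI p₂ hp₂d
      refine ⟨x₀, by linarith, h2, Or.inl ⟨h1, fun x hx => ?_⟩⟩
      have h4 := h3 x hx
      rw [abs_of_nonneg (hpos₂ x ⟨by linarith [hx.1], by linarith [hx.2]⟩)] at h4
      nlinarith
    · obtain ⟨x₀, h1, h2, h3⟩ := hI (p₁.comp (-X)) (by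
        rw [natDegree_comp, natDegree_neg, natDegree_X, mul_one]; exact hp₁d)
      refine ⟨-(x₀ + ρ), by linarith, by linarith, Or.inr ⟨by linarith, fun x hx => ?_⟩⟩
      have h4 := h3 (-x) ⟨by linarith [hx.2], by linarith [hx.1]⟩
      rw [eval_comp, eval_neg, eval_X, neg_neg, coeffNorm_comp_neg_X,
        abs_of_nonneg (hpos₁ x ⟨by linarith [hx.1], by linarith [hx.2]⟩)] at h4
      nlinarith
  -- one-sided approximation at the scale `η`
  have hη1 : η ≤ 1 := (min_le_left _ _).trans (min_le_left _ _)
  obtain ⟨μ₁, hμ₁W, hμ₁M, hμ₁R, hμ₁n, hμ₁p⟩ := hS η hη0 hη1 W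
    (hW.mono (min_le_left _ _) (by linarith) hηL) (κ⁻¹ • D) ((natDegree_smul_le _ _).trans hDd)
  simp only [eval_smul, smul_eq_mul] at hμ₁p
  replace hμ₁M : mass μ₁ ≤ K₁ * κ⁻¹ * (η ^ r)⁻¹ * N := by
    rw [coeffNorm_smul, abs_of_pos (inv_pos.2 hκ0)] at hμ₁M
    exact hμ₁M.trans (le_of_eq (by ring))
  -- the remaining moments are small
  set E := Q - powSum k μ₁ with hE
  have hEd : E.natDegree ≤ k :=
    (natDegree_sub_le _ _).trans (max_le hQd (natDegree_powSum_le _ _))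
  have hE0 : derivative^[q] E = 0 := by
    rw [hE, iterate_derivative_sub, hk, iterate_derivative_powSum, hμ₁R, smul_smul, ← hk, ← hκ,
      mul_inv_cancel₀ hκ0.ne', one_smul, ← hD, sub_self]
  have hEN : coeffNorm k E ≤ K₂ * η * N := by
    have hB : ∀ i ≤ k, |E.coeff i| ≤ 2 ^ k * (η * L) ^ (r + 1) * (K₁ * κ⁻¹ * (η ^ r)⁻¹ * N) := by
      intro i hi
      rcases lt_or_ge i q with h | h
      · rw [hE, coeff_sub, hlow i h, zero_sub, abs_neg]
        refine (abs_coeff_powSum_le k μ₁ (fun w hw => (hμ₁W w hw).2) i).trans ?_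
        have h1 : (k.choose i : ℝ) ≤ 2 ^ k := by exact_mod_cast Nat.choose_le_two_pow k i
        have h2 : (η * L) ^ (k - i) ≤ (η * L) ^ (r + 1) :=
          pow_le_pow_of_le_one (by positivity) (by linarith) (by lia)
        have h3 := mass_nonneg μ₁
        gcongr
      · have h1 := congrArg (fun P => coeff P (i - q)) hE0
        simp only [coeff_iterate_derivative, Nat.sub_add_cancel h, coeff_zero, smul_eq_zero] at h1
        rcases h1 with h1 | h1
        · exact absurd h1 (Nat.descFactorial_pos.2 h).ne'
        · rw [h1, abs_zero]; positivity
    refine (coeffNorm_le_of_coeff_le hB).trans (le_of_eq ?_)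
    rw [hK₂, mul_pow, pow_succ η]
    field_simp
  obtain ⟨u, hu, hsep⟩ := (hW.mono (min_le_right η ρ') (a' := y₀) (b' := y₀ + ρ) (by linarith)
    hy1).exists_nodes hρ'pos.le k (by rw [hρ', mul_div_cancel₀ _ (by positivity)])
  have hu' : ∀ i, u i ∈ Set.Icc y₀ (y₀ + ρ) := fun i => by
    have := (hu i).2
    rwa [hρ', mul_div_cancel₀ _ (by positivity)] at this
  obtain ⟨μ₂, hμ₂u, hμ₂E, hμ₂M⟩ := hV u (fun i => abs_le.2
    ⟨by linarith [(hu' i).1], by linarith [(hu' i).2]⟩) hsep E hEd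
  have hμ₂W : ∀ w ∈ μ₂.support, w ∈ W ∧ w ∈ Set.Icc y₀ (y₀ + ρ) := fun w hw => by
    obtain ⟨i, rfl⟩ := hμ₂u w hw
    exact ⟨(hu i).1, hu' i⟩
  have hμ₂M' : mass μ₂ ≤ K₃ * (K₂ * η) * N := by
    calc mass μ₂ ≤ K₃ * coeffNorm k E := hμ₂M
      _ ≤ K₃ * (K₂ * η * N) := by gcongr
      _ = _ := by ring
  have hμ₂0 : powSum r μ₂ = 0 := by
    have h1 := iterate_derivative_powSum q r μ₂
    rw [← hk, hμ₂E, hE0, eq_comm, smul_eq_zero] at h1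
    exact h1.resolve_left hκ0.ne'
  have hsmall : ∀ x ∈ Set.Icc (-1 / 2 : ℝ) (1 / 2), κ * |spl r μ₂ x| ≤ c / 2 * N := fun x hx => by
    have h1 := abs_spl_le r (μ := μ₂) (x := x) zero_le_one fun w hw => by
      linarith [(hμ₂W w hw).2.1, hx.2]
    rw [one_pow, one_mul] at h1
    calc κ * |spl r μ₂ x| ≤ κ * (K₃ * (K₂ * η) * N) := by gcongr; exact h1.trans hμ₂M'
      _ = κ * (K₃ * (K₂ * η)) * N := by ring
      _ ≤ c / 2 * N := by gcongr
  have hout : ∀ x, x ∉ Set.Icc y₀ (y₀ + ρ) → spl r μ₂ x = 0 := fun x hx => by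
    rcases lt_or_ge x y₀ with h | h
    · exact spl_eq_zero hr fun w hw => h.le.trans (hμ₂W w hw).2.1
    · have h2 : y₀ + ρ ≤ x := by
        by_contra! h2
        exact hx ⟨h, h2.le⟩
      rw [spl_eq_eval fun w hw => (hμ₂W w hw).2.2.trans h2, hμ₂0, eval_zero]
  have hneg : ∀ x, x ≤ 0 → p₁.eval x ≤ p₁.eval x + κ * spl r μ₁ x := fun x hx =>
    le_add_of_nonneg_right (mul_nonneg hκ0.le (hμ₁n x hx))
  have hposi : ∀ x, 0 ≤ x → p₂.eval x ≤ p₁.eval x + κ * spl r μ₁ x := fun x hx => by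
    have h1 := mul_le_mul_of_nonneg_left (hμ₁p x hx) hκ0.le
    rw [mul_inv_cancel_left₀ hκ0.ne', hDp, eval_sub] at h1
    linarith
  refine ⟨μ₁ + μ₂, fun w hw => ?_, ?_, ?_, fun x hx => ?_⟩
  · rcases Finset.mem_union.1 (Finsupp.support_add hw) with h | h
    · have := abs_le.1 (hμ₁W w h).2
      exact ⟨(hμ₁W w h).1, by linarith, by linarith⟩
    · exact ⟨(hμ₂W w h).1, by linarith [(hμ₂W w h).2.1], by linarith [(hμ₂W w h).2.2]⟩
  · rw [map_add, hμ₂E, hE, add_sub_cancel]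
  · calc mass (μ₁ + μ₂) ≤ (K₁ * κ⁻¹ * (η ^ r)⁻¹ + K₃ * (K₂ * η)) * N := by
          linarith [mass_add_le μ₁ μ₂]
      _ ≤ (K₁ * κ⁻¹ * (η ^ r)⁻¹ + K₃ * (K₂ * η)) * ((r + 1) * κ * coeffNorm k Q) := by gcongr
      _ = _ := by ring
  · rw [map_add, Pi.add_apply, mul_add, ← add_assoc]
    by_cases hxU : x ∈ Set.Icc y₀ (y₀ + ρ)
    · have h1 := hsmall x hx
      have h2 := mul_le_mul_of_nonneg_left (neg_abs_le (spl r μ₂ x)) hκ0.le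
      rcases hbig with ⟨h3, h4⟩ | ⟨h3, h4⟩
      · linarith [h4 x hxU, hposi x (h3.trans hxU.1)]
      · linarith [h4 x hxU, hneg x (hxU.2.trans h3)]
    · rw [hout x hxU, mul_zero, add_zero]
      rcases le_total x 0 with h | h
      · exact (hpos₁ x ⟨hx.1, h⟩).trans (hneg x h)
      · exact (hpos₂ x ⟨h, hx.2⟩).trans (hposi x h)

theorem exists_iteratedDeriv_eq_zero (n : ℕ) {f : ℝ → ℝ} (hf : ContDiff ℝ n f) {t : ℕ → ℝ}
    (ht : ∀ i < n, t i < t (i + 1)) (h0 : ∀ i ≤ n, f (t i) = 0) :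
    ∃ ξ ∈ Set.Icc (t 0) (t n), iteratedDeriv n f ξ = 0 := by
  induction n generalizing f t with
  | zero => exact ⟨t 0, by simp, by simpa using h0 0 le_rfl⟩
  | succ n ih =>
    have hroot : ∀ i, ∃ x, i < n + 1 → x ∈ Set.Ioo (t i) (t (i + 1)) ∧ deriv f x = 0 := fun i => by
      by_cases hi : i < n + 1
      · obtain ⟨x, hx, hx0⟩ := exists_deriv_eq_zero (ht i hi) hf.continuous.continuousOn
          ((h0 i hi.le).trans (h0 (i + 1) hi).symm)
        exact ⟨x, fun _ => ⟨hx, hx0⟩⟩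
      · exact ⟨0, fun h => absurd h hi⟩
    choose τ hτ using hroot
    have hf' : ContDiff ℝ n (deriv f) := by
      push_cast at hf
      exact (contDiff_succ_iff_deriv.1 hf).2.2
    obtain ⟨ξ, hξ, hξ0⟩ := ih hf' (t := τ)
      (fun i hi => (hτ i (by lia)).1.2.trans (hτ (i + 1) (by lia)).1.1)
      (fun i hi => (hτ i (by lia)).2)
    refine ⟨ξ, ⟨(hτ 0 (by lia)).1.1.le.trans hξ.1, hξ.2.trans (hτ n (by lia)).1.2.le⟩, ?_⟩
    rw [iteratedDeriv_succ', hξ0]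

theorem contDiff_eval (P : ℝ[X]) {n : WithTop ℕ∞} : ContDiff ℝ n fun x => P.eval x := by
  simpa [aeval_def] using P.contDiff_aeval (𝕜 := ℝ) n

theorem iteratedDeriv_eval (n : ℕ) (P : ℝ[X]) :
    iteratedDeriv n (fun x => P.eval x) = fun x => (derivative^[n] P).eval x := by
  induction n generalizing P with
  | zero => simp
  | succ n ih =>
    rw [iteratedDeriv_succ', Function.iterate_succ_apply, ← ih]
    congr 1
    funext x
    exact P.deriv

/-- The mean value theorem for divided differences. -/
theorem exists_dividedDiff_eq (q : ℕ) {f : ℝ → ℝ} (hf : ContDiff ℝ q f) {a b : ℝ}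
    {t : Fin (q + 1) → ℝ} (ht : Function.Injective t) (hab : ∀ i, t i ∈ Set.Icc a b) :
    ∃ ξ ∈ Set.Icc a b, dividedDiff q f t = iteratedDeriv q f ξ / q.factorial := by
  classical
  have hinj : Set.InjOn t (Finset.univ : Finset (Fin (q + 1))) := ht.injOn
  set I := Lagrange.interpolate Finset.univ t (fun i => f (t i)) with hI
  have hIdeg : I.degree < (Finset.univ : Finset (Fin (q + 1))).card :=
    Lagrange.degree_interpolate_lt _ hinj
  have hIe : ∀ i, I.eval (t i) = f (t i) := fun i =>
    Lagrange.eval_interpolate_at_node _ hinj (Finset.mem_univ i)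
  have hIc : I.coeff q = dividedDiff q f t := by
    have := Lagrange.coeff_eq_sum hinj hIdeg
    simpa [hIe, dividedDiff] using this
  have hcard : (Finset.univ.image t).card = q + 1 := by
    rw [Finset.card_image_of_injective _ ht]; simp
  set e := (Finset.univ.image t).orderEmbOfFin hcard with he
  have hmem : ∀ i, ∃ j, t j = e i := fun i => by
    obtain ⟨j, _, hj⟩ := Finset.mem_image.1 ((Finset.univ.image t).orderEmbOfFin_mem hcard i)
    exact ⟨j, hj⟩
  set T : ℕ → ℝ := fun i => e ⟨min i q, by lia⟩ with hT
  have hTmem : ∀ i, ∃ j, t j = T i := fun i => hmem _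
  obtain ⟨ξ, hξ, hξ0⟩ := exists_iteratedDeriv_eq_zero q (f := fun x => f x - I.eval x)
    (hf.sub (contDiff_eval I)) (t := T)
    (fun i hi => e.strictMono (Fin.mk_lt_mk.2 (by lia)))
    (fun i _ => by
      obtain ⟨j, hj⟩ := hTmem i
      simp only [← hj, hIe, sub_self])
  refine ⟨ξ, ?_, ?_⟩
  · obtain ⟨i, hi⟩ := hTmem 0
    obtain ⟨j, hj⟩ := hTmem q
    rw [← hi, ← hj] at hξ
    exact ⟨(hab i).1.trans hξ.1, hξ.2.trans (hab j).2⟩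
  · rw [iteratedDeriv_fun_sub hf.contDiffAt (contDiff_eval I).contDiffAt, iteratedDeriv_eval,
      sub_eq_zero] at hξ0
    have hd : (derivative^[q] I).natDegree ≤ 0 := by
      refine natDegree_iterate_derivative_le ?_
      rw [add_zero]
      refine natDegree_le_iff_coeff_eq_zero.2 fun N hN =>
        coeff_eq_zero_of_degree_lt (hIdeg.trans_le ?_)
      rw [Finset.card_univ, Fintype.card_fin]
      exact_mod_cast hN
    simp only at hξ0
    rw [hξ0, eq_C_of_natDegree_le_zero hd, eval_C, coeff_iterate_derivative, zero_add,
      Nat.descFactorial_self, hIc, nsmul_eq_mul, mul_div_cancel_left₀ _ (by positivity)]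

theorem qMonotoneOn_of_iteratedDeriv_nonneg (q : ℕ) {f : ℝ → ℝ} (hf : ContDiff ℝ q f) {a b : ℝ}
    (h : ∀ x ∈ Set.Icc a b, 0 ≤ iteratedDeriv q f x) : QMonotoneOn q f (Set.Icc a b) := by
  intro t ht htm
  obtain ⟨ξ, hξ, h1⟩ := exists_dividedDiff_eq q hf ht htm
  rw [h1]
  exact div_nonneg (h ξ hξ) (by positivity)

theorem QMonotoneOn.iterate_derivative_nonneg {q : ℕ} {f : ℝ → ℝ} {J : Set ℝ}
    (hf : QMonotoneOn q f J) {c d : ℝ} (hcd : c < d) (hJ : Set.Icc c d ⊆ J) {P : ℝ[X]}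
    (hP : ∀ x ∈ Set.Ioo c d, f x = P.eval x) {x : ℝ} (hx : x ∈ Set.Icc c d) :
    0 ≤ (derivative^[q] P).eval x := by
  have hcont : Continuous fun x => (derivative^[q] P).eval x := (derivative^[q] P).continuous
  have hclosed : IsClosed {x | 0 ≤ (derivative^[q] P).eval x} := isClosed_le continuous_const hcont
  rw [← closure_Ioo hcd.ne] at hx
  refine closure_minimal (fun y hy => ?_) hclosed hx
  by_contra! hneg
  simp only [Set.mem_ofPred_eq, not_le] at hneg
  have hnhds : {y | (derivative^[q] P).eval y < 0} ∩ Set.Ioo c d ∈ nhds y :=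
    Filter.inter_mem (hcont.continuousAt.eventually_lt continuousAt_const hneg)
      (Ioo_mem_nhds hy.1 hy.2)
  obtain ⟨ε, hε, hball⟩ := Metric.mem_nhds_iff.1 hnhds
  rw [Real.ball_eq_Ioo] at hball
  set t : Fin (q + 1) → ℝ := fun i => y + ε / 2 * (i / (q + 1)) with ht
  have hinj : Function.Injective t := fun i j hij => by
    have h1 : ε / 2 ≠ 0 := by positivity
    have h2 : (q : ℝ) + 1 ≠ 0 := by positivity
    simp only [ht, add_right_inj, mul_eq_mul_left_iff, h1, or_false, div_left_inj' h2,
      Nat.cast_inj] at hij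
    exact Fin.ext hij
  have htI : ∀ i, t i ∈ Set.Icc y (y + ε / 2) := fun i => by
    have h1 : 0 ≤ ε / 2 * (i / (q + 1)) := by positivity
    have h2 : ε / 2 * (i / (q + 1)) ≤ ε / 2 := by
      refine mul_le_of_le_one_right (by positivity) (div_le_one_of_le₀ ?_ (by positivity))
      exact_mod_cast i.2.le
    constructor <;> simp only [ht] <;> linarith
  have hsub : Set.Icc y (y + ε / 2) ⊆ {y | (derivative^[q] P).eval y < 0} ∩ Set.Ioo c d :=
    fun z hz => hball ⟨by linarith [hz.1], by linarith [hz.2]⟩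
  have h0 := hf t hinj fun i => hJ (Set.Ioo_subset_Icc_self (hsub (htI i)).2)
  have heq : dividedDiff q f t = dividedDiff q (fun x => P.eval x) t :=
    Finset.sum_congr rfl fun i _ => by rw [hP _ (hsub (htI i)).2]
  obtain ⟨ξ, hξ, h1⟩ := exists_dividedDiff_eq q (contDiff_eval P) hinj htI
  rw [heq, h1, iteratedDeriv_eval] at h0
  have h2 : (derivative^[q] P).eval ξ < 0 := (hsub hξ).1
  have h3 : (derivative^[q] P).eval ξ / q.factorial < 0 := div_neg_of_neg_of_pos h2 (by positivity)
  linarith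

theorem iteratedDerivWithin_eq_of_eq_polynomial {n : ℕ} {a b : ℝ} {f : ℝ → ℝ} (hab : a < b)
    (hf : ContDiffOn ℝ n f (Set.Icc a b)) {c d : ℝ} (hcd : c < d)
    (hJ : Set.Icc c d ⊆ Set.Icc a b) {P : ℝ[X]} (hP : ∀ x ∈ Set.Ioo c d, f x = P.eval x)
    {l : ℕ} (hl : l ≤ n) {x : ℝ} (hx : x ∈ Set.Icc c d) :
    iteratedDerivWithin l f (Set.Icc a b) x = (derivative^[l] P).eval x := by
  have hcont : ContinuousOn (iteratedDerivWithin l f (Set.Icc a b)) (Set.Icc c d) :=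
    (hf.continuousOn_iteratedDerivWithin (by exact_mod_cast hl) (uniqueDiffOn_Icc hab)).mono hJ
  have heq : Set.EqOn (iteratedDerivWithin l f (Set.Icc a b))
      (fun x => (derivative^[l] P).eval x) (Set.Ioo c d) := fun y hy => by
    have hset : Set.Icc a b =ᶠ[nhds y] Set.Ioo c d := by
      filter_upwards [Ioo_mem_nhds hy.1 hy.2] with z hz
      exact propext ⟨fun _ => hz, fun _ => hJ (Set.Ioo_subset_Icc_self hz)⟩
    have h1 : iteratedDerivWithin l f (Set.Icc a b) y = iteratedDerivWithin l f (Set.Ioo c d) y := by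
      rw [iteratedDerivWithin, iteratedDerivWithin, iteratedFDerivWithin_congr_set hset]
    rw [h1, iteratedDerivWithin_congr hP hy,
      iteratedDerivWithin_of_isOpen isOpen_Ioo hy, iteratedDeriv_eval]
  refine heq.of_subset_closure hcont (derivative^[l] P).continuous.continuousOn
    Set.Ioo_subset_Icc_self ?_ hx
  rw [closure_Ioo hcd.ne]

theorem natDegree_comp_affine_le {d : ℕ} {P : ℝ[X]} (hP : P.natDegree ≤ d) (z h : ℝ) :
    (P.comp (C z + C h * X)).natDegree ≤ d := by
  refine natDegree_comp_le.trans ?_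
  have h1 : (C z + C h * X : ℝ[X]).natDegree ≤ 1 := by
    rw [add_comm]; exact natDegree_linear_le
  calc P.natDegree * (C z + C h * X : ℝ[X]).natDegree ≤ d * 1 := Nat.mul_le_mul hP h1
    _ = d := mul_one d

theorem eval_comp_affine (P : ℝ[X]) (z h t : ℝ) :
    (P.comp (C z + C h * X)).eval t = P.eval (z + h * t) := by
  simp

theorem iterate_derivative_comp_affine (q : ℕ) (P : ℝ[X]) (z h : ℝ) :
    derivative^[q] (P.comp (C z + C h * X))
      = C (h ^ q) * (derivative^[q] P).comp (C z + C h * X) := by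
  induction q generalizing P with
  | zero => simp
  | succ q ih =>
    have h1 : derivative (P.comp (C z + C h * X))
        = C h * (derivative P).comp (C z + C h * X) := by
      rw [derivative_comp]; simp
    rw [Function.iterate_succ_apply, Function.iterate_succ_apply, h1, iterate_derivative_C_mul, ih,
      ← mul_assoc, ← C_mul, pow_succ']

theorem sum_choose_mul_eval_eq_zero {k : ℕ} {P : ℝ[X]} (hP : P.natDegree < k) (y σ : ℝ) :
    ∑ i ∈ Finset.range (k + 1), (k.choose i : ℝ) * (-1) ^ (k - i) * P.eval (y + i * σ) = 0 := by
  obtain ⟨d, rfl⟩ : ∃ d, k = d + 1 := ⟨k - 1, by lia⟩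
  have h1 := congrFun (Polynomial.fwdDiff_iter_eq_zero_of_degree_lt (n := d + 1)
    (Nat.lt_succ_of_le (natDegree_comp_affine_le (Nat.lt_succ_iff.1 hP) y σ))) 0
  rw [fwdDiff_iter_eq_sum_shift, Pi.zero_apply] at h1
  rw [← h1]
  refine Finset.sum_congr rfl fun i _ => ?_
  rw [eval_comp_affine, zsmul_eq_mul, zero_add, nsmul_one]
  push_cast
  ring_nf

/-- Lower bound for the modulus of smoothness of a function with a polynomial jump at `z`. -/
theorem le_modulusOn {k : ℕ} {α β z h : ℝ} (hh : 0 < h) (hα : α ≤ z - h / 2)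
    (hβ : z + h / 2 ≤ β) {s : ℝ → ℝ} {P₁ P₂ : ℝ[X]} (hP₁ : P₁.natDegree ≤ k)
    (hs₁ : ∀ x ∈ Set.Icc α z, s x = P₁.eval x) (hs₂ : ∀ x ∈ Set.Icc z β, s x = P₂.eval x)
    {x₀ ℓ c : ℝ} (hℓ : 0 < ℓ) (hx₀ : z ≤ x₀) (hx₁ : x₀ + ℓ ≤ z + h / (2 * (k + 1))) (hc : 0 ≤ c)
    (hQ : ∀ y ∈ Set.Icc x₀ (x₀ + ℓ), c ≤ |(P₂ - P₁).eval y|) {p : ℝ≥0∞} (hp : 0 < p) :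
    ENNReal.ofReal c * ENNReal.ofReal ℓ ^ (1 / p.toReal)
      ≤ modulusOn (k + 1) s (Set.Icc α β) p := by
  set σ := h / (2 * (k + 1)) with hσ
  have hσ0 : 0 < σ := by positivity
  have hσh : (k + 1) * σ = h / 2 := by rw [hσ]; field_simp
  have hk0 : (0 : ℝ) ≤ k := by positivity
  have hσle : σ ≤ h / 2 := by nlinarith
  have hvol : volume.real (Set.Icc α β) = β - α := Real.volume_real_Icc_of_le (by linarith)
  have hval : ∀ x, x + (k + 1) * σ / 2 ∈ Set.Icc x₀ (x₀ + ℓ) →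
      symmDiffOn (k + 1) σ s (Set.Icc α β) x = (P₂ - P₁).eval (x + (k + 1) * σ / 2) := by
    intro x hx
    have hcond : x - (k + 1 : ℕ) * σ / 2 ∈ Set.Icc α β ∧ x + (k + 1 : ℕ) * σ / 2 ∈ Set.Icc α β := by
      push_cast
      exact ⟨⟨by linarith [hx.1], by linarith [hx.2]⟩, ⟨by linarith [hx.1], by linarith [hx.2]⟩⟩
    rw [symmDiffOn, if_pos hcond, Finset.sum_range_succ]
    have h0 := sum_choose_mul_eval_eq_zero (Nat.lt_succ_of_le hP₁) (x - (k + 1 : ℕ) * σ / 2) σ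
    rw [Finset.sum_range_succ] at h0
    have hlast : x - ((k + 1 : ℕ) : ℝ) * σ / 2 + ((k + 1 : ℕ) : ℝ) * σ = x + (k + 1) * σ / 2 := by
      push_cast; ring
    have hsum : ∑ i ∈ Finset.range (k + 1), ((k + 1).choose i : ℝ) * (-1) ^ (k + 1 - i) *
          s (x - (k + 1 : ℕ) * σ / 2 + i * σ)
        = ∑ i ∈ Finset.range (k + 1), ((k + 1).choose i : ℝ) * (-1) ^ (k + 1 - i) *
          P₁.eval (x - (k + 1 : ℕ) * σ / 2 + i * σ) := by
      refine Finset.sum_congr rfl fun i hi => ?_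
      have hi' : (i : ℝ) ≤ k := by exact_mod_cast Nat.lt_succ_iff.1 (Finset.mem_range.1 hi)
      have hi0 : (0 : ℝ) ≤ i := by positivity
      rw [hs₁]
      push_cast
      constructor
      · nlinarith [hx.1]
      · nlinarith [hx.2]
    rw [hsum, hlast]
    rw [hlast] at h0
    rw [hs₂ _ ⟨by linarith [hx.1], by linarith [hx.2]⟩, eval_sub]
    simp only [Nat.choose_self, Nat.sub_self, pow_zero, Nat.cast_one, one_mul] at h0 ⊢
    linarith
  have hmem : σ ∈ Set.Ioc 0 (volume.real (Set.Icc α β)) := ⟨hσ0, by rw [hvol]; linarith⟩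
  refine le_trans ?_ (le_iSup₂ (f := fun h (_ : h ∈ Set.Ioc 0 (volume.real (Set.Icc α β))) =>
    eLpNorm (symmDiffOn (k + 1) h s (Set.Icc α β)) p (volume.restrict (Set.Icc α β))) σ hmem)
  set A := Set.Icc (x₀ - (k + 1) * σ / 2) (x₀ - (k + 1) * σ / 2 + ℓ) with hA
  have hAJ : A ⊆ Set.Icc α β := fun x hx => ⟨by linarith [hx.1], by linarith [hx.2]⟩
  have hAm : volume.restrict (Set.Icc α β) A = ENNReal.ofReal ℓ := by
    rw [Measure.restrict_apply measurableSet_Icc, Set.inter_eq_left.2 hAJ, Real.volume_Icc]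
    congr 1
    ring
  have hA0 : ENNReal.ofReal ℓ ≠ 0 := (ENNReal.ofReal_pos.2 hℓ).ne'
  have h1 := eLpNorm_indicator_const' (c := c) (p := p) (s := A)
    (μ := volume.restrict (Set.Icc α β)) measurableSet_Icc (by rwa [hAm]) hp.ne'
  rw [hAm, Real.enorm_eq_ofReal hc] at h1
  rw [← h1]
  refine eLpNorm_mono fun x => ?_
  by_cases hx : x ∈ A
  · have hx' : x + (k + 1) * σ / 2 ∈ Set.Icc x₀ (x₀ + ℓ) :=
      ⟨by linarith [hx.1], by linarith [hx.2]⟩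
    rw [Set.indicator_of_mem hx, hval x hx', Real.norm_of_nonneg hc]
    exact hQ _ hx'
  · rw [Set.indicator_of_notMem hx, norm_zero]
    exact norm_nonneg _

theorem eLpNorm_le_of_bound_on_Icc {f : ℝ → ℝ} {J : Set ℝ} (hJ : MeasurableSet J) {a b B : ℝ}
    (hB : 0 ≤ B) (h : ∀ x ∈ J, x ∈ Set.Icc a b → |f x| ≤ B)
    (h0 : ∀ x ∈ J, x ∉ Set.Icc a b → f x = 0) (p : ℝ≥0∞) :
    eLpNorm f p (volume.restrict J)
      ≤ ENNReal.ofReal B * ENNReal.ofReal (b - a) ^ (1 / p.toReal) := by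
  have h1 : eLpNorm f p (volume.restrict J)
      ≤ eLpNorm ((Set.Icc a b).indicator fun _ => B) p (volume.restrict J) := by
    refine eLpNorm_mono_ae (ae_restrict_of_forall_mem hJ fun x hx => ?_)
    by_cases hxI : x ∈ Set.Icc a b
    · rw [Set.indicator_of_mem hxI, Real.norm_of_nonneg hB]
      exact h x hx hxI
    · rw [h0 x hx hxI, norm_zero]
      exact norm_nonneg _
  refine h1.trans ((eLpNorm_indicator_const_le _ _).trans ?_)
  rw [Real.enorm_eq_ofReal hB]
  gcongr
  rw [← Real.volume_Icc]
  exact Measure.restrict_apply_le _ _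

/-- Smoothing of a `q`-monotone piecewise polynomial with one knot `z`. -/
theorem exists_smoothing_of_one_knot (q r : ℕ) (hr : 1 ≤ r) :
    ∃ δ > 0, ∃ K : ℝ≥0∞ → NNReal, ∀ z h α β : ℝ, 0 < h → α ≤ z - h / 2 → z + h / 2 ≤ β →
    ∀ W : Set ℝ, Meshed W (δ * h) (z - h / 2) (z + h / 2) →
    ∀ P₁ P₂ : ℝ[X], P₁.natDegree ≤ q + r → P₂.natDegree ≤ q + r →
    (∀ l < q, (derivative^[l] (P₂ - P₁)).eval z = 0) →
    (∀ x ∈ Set.Icc α z, 0 ≤ (derivative^[q] P₁).eval x) →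
    (∀ x ∈ Set.Icc z β, 0 ≤ (derivative^[q] P₂).eval x) →
    ∀ s : ℝ → ℝ, (∀ x ∈ Set.Icc α z, s x = P₁.eval x) → (∀ x ∈ Set.Icc z β, s x = P₂.eval x) →
    ∃ μ : ℝ →₀ ℝ, (∀ w ∈ μ.support, w ∈ W ∧ w ∈ Set.Icc α β) ∧ powSum (q + r) μ = P₂ - P₁ ∧
      (∀ x ∈ Set.Icc α β,
        0 ≤ (derivative^[q] P₁).eval x + (q + r).descFactorial q * spl r μ x) ∧
      ∀ p : ℝ≥0∞, 0 < p →
        eLpNorm (fun x => s x - (P₁.eval x + spl (q + r) μ x)) p (volume.restrict (Set.Icc α β))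
          ≤ K p * modulusOn (q + r + 1) s (Set.Icc α β) p := by
  obtain ⟨δ, hδ, K, hK, hloc⟩ := exists_local_correction q r hr
  set k := q + r with hk
  obtain ⟨c, hc, ρ, hρ, hρ1, hI⟩ := exists_Icc_coeffNorm_le k (a := 1 / (2 * (k + 1)))
    (by positivity) (by
      rw [div_le_one (by positivity)]
      linarith [Nat.cast_nonneg (α := ℝ) k])
  refine ⟨δ, hδ, fun p => ((K + 1) / c * ρ ^ (-(1 / p.toReal))).toNNReal, ?_⟩
  intro z h α β hh hα hβ W hW P₁ P₂ hP₁ hP₂ hjump hpos₁ hpos₂ s hs₁ hs₂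
  set φ : ℝ[X] := C z + C h * X with hφ
  have hscale : ∀ x, ∃ t, x = z + h * t := fun x => ⟨(x - z) / h, by field_simp; ring⟩
  have hW' : Meshed ((fun t => z + h * t) ⁻¹' W) δ (-1 / 2) (1 / 2) := fun t ht ht' => by
    obtain ⟨w, hw, h1, h2⟩ := hW (z + h * t) (by nlinarith) (by nlinarith)
    refine ⟨(w - z) / h, ?_, ?_, ?_⟩
    · simpa [mul_div_cancel₀ _ hh.ne'] using hw
    · rw [le_div_iff₀ hh]; linarith
    · rw [div_le_iff₀ hh]; linarith
  set Q := (P₂ - P₁).comp φ with hQ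
  have hQs : P₂.comp φ - P₁.comp φ = Q := by rw [hQ, sub_comp]
  obtain ⟨μ, hμW, hμQ, hμM, hμp⟩ := hloc _ hW' (P₁.comp φ) (P₂.comp φ)
    (natDegree_comp_affine_le hP₁ _ _) (natDegree_comp_affine_le hP₂ _ _)
    (fun i hi => by
      have h1 : (derivative^[i] Q).coeff 0 = 0 := by
        rw [coeff_zero_eq_eval_zero, hQ, iterate_derivative_comp_affine, eval_mul,
          eval_comp_affine, mul_zero, add_zero, hjump i hi, mul_zero]
      rw [coeff_iterate_derivative, zero_add, Nat.descFactorial_self, smul_eq_zero] at h1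
      rw [hQs]
      exact h1.resolve_left (Nat.factorial_ne_zero i))
    (fun t ht => by
      rw [iterate_derivative_comp_affine, eval_mul, eval_C, eval_comp_affine]
      exact mul_nonneg (by positivity) (hpos₁ _ ⟨by nlinarith [ht.1], by nlinarith [ht.2]⟩))
    (fun t ht => by
      rw [iterate_derivative_comp_affine, eval_mul, eval_C, eval_comp_affine]
      exact mul_nonneg (by positivity) (hpos₂ _ ⟨by nlinarith [ht.1], by nlinarith [ht.2]⟩))
  rw [hQs] at hμQ hμM
  set N := coeffNorm k Q with hN
  have hN0 : 0 ≤ N := coeffNorm_nonneg _ _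
  have hQd : Q.natDegree ≤ k :=
    natDegree_comp_affine_le ((natDegree_sub_le _ _).trans (max_le hP₂ hP₁)) _ _
  set ν := (h ^ k)⁻¹ • affineMap z h μ with hν
  have hνk : ∀ t, spl k ν (z + h * t) = spl k μ t := fun t => by
    rw [hν, map_smul, Pi.smul_apply, spl_affineMap _ hh.le, smul_eq_mul,
      inv_mul_cancel_left₀ (by positivity)]
  have hνr : ∀ t, h ^ q * spl r ν (z + h * t) = spl r μ t := fun t => by
    rw [hν, map_smul, Pi.smul_apply, spl_affineMap _ hh.le, smul_eq_mul, hk, pow_add]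
    field_simp
  have hνW : ∀ w ∈ ν.support, w ∈ W ∧ w ∈ Set.Icc (z - h / 2) (z + h / 2) := fun w hw => by
    obtain ⟨t, ht, rfl⟩ := exists_of_mem_support_affineMap (Finsupp.support_smul hw)
    obtain ⟨h1, h2⟩ := hμW t ht
    exact ⟨h1, by nlinarith [h2.1], by nlinarith [h2.2]⟩
  have hνQ : powSum k ν = P₂ - P₁ := by
    refine Polynomial.funext fun x => ?_
    obtain ⟨t, rfl⟩ := hscale x
    rw [hν, map_smul, eval_smul, eval_powSum_affineMap, smul_eq_mul,
      inv_mul_cancel_left₀ (by positivity), hμQ, hQ, eval_comp_affine]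
  have hνr' : ((q + r).descFactorial q : ℝ) • powSum r ν = derivative^[q] (P₂ - P₁) := by
    rw [← iterate_derivative_powSum, ← hk, hνQ]
  refine ⟨ν, fun w hw => ⟨(hνW w hw).1, by linarith [(hνW w hw).2.1], by linarith [(hνW w hw).2.2]⟩,
    hνQ, fun x hx => ?_, fun p hp => ?_⟩
  · rcases lt_or_ge x (z - h / 2) with hxl | hxl
    · rw [spl_eq_zero hr fun w hw => hxl.le.trans (hνW w hw).2.1, mul_zero, add_zero]
      exact hpos₁ x ⟨hx.1, by linarith⟩
    rcases lt_or_ge (z + h / 2) x with hxr | hxr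
    · rw [spl_eq_eval fun w hw => (hνW w hw).2.2.trans hxr.le, ← smul_eq_mul, ← eval_smul, hk, hνr',
        iterate_derivative_sub, eval_sub, add_sub_cancel]
      exact hpos₂ x ⟨by linarith, hx.2⟩
    · obtain ⟨t, rfl⟩ := hscale x
      have h1 := hμp t ⟨by nlinarith, by nlinarith⟩
      rw [iterate_derivative_comp_affine, eval_mul, eval_C, eval_comp_affine, ← hνr,
        mul_left_comm, ← mul_add] at h1
      exact nonneg_of_mul_nonneg_right h1 (by positivity)
  · obtain ⟨t₀, ht0, ht1, hbig⟩ := hI Q hQd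
    have hlow := le_modulusOn (k := k) (c := c * N) (x₀ := z + h * t₀) (ℓ := h * ρ) hh hα hβ hP₁
      hs₁ hs₂ (by positivity) (by nlinarith) (by
        calc z + h * t₀ + h * ρ = z + h * (t₀ + ρ) := by ring
          _ ≤ z + h * (1 / (2 * (k + 1))) := by gcongr
          _ = z + h / (2 * (k + 1)) := by ring)
      (by positivity) (fun y hy => by
        obtain ⟨t, rfl⟩ := hscale y
        have h1 := hbig t ⟨by nlinarith [hy.1], by nlinarith [hy.2]⟩
        rwa [hQ, eval_comp_affine] at h1) hp
    have hup := eLpNorm_le_of_bound_on_Icc (f := fun x => s x - (P₁.eval x + spl k ν x))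
      (J := Set.Icc α β) (a := z - h / 2) (b := z + h / 2) (B := (K + 1) * N) measurableSet_Icc
      (by positivity) (fun x hx hxI => by
        obtain ⟨t, rfl⟩ := hscale x
        have htl : -1 / 2 ≤ t := by nlinarith [hxI.1]
        have htr : t ≤ 1 / 2 := by nlinarith [hxI.2]
        have h1 := abs_spl_le k (μ := μ) (x := t) zero_le_one fun w hw => by
          linarith [(hμW w hw).2.1]
        rw [one_pow, one_mul, ← hνk] at h1
        have h2 : |spl k ν (z + h * t)| ≤ K * N := h1.trans hμM
        rcases le_total t 0 with ht | ht
        · rw [hs₁ _ ⟨hx.1, by nlinarith⟩, sub_add_cancel_left, abs_neg]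
          linarith
        · have h3 := abs_eval_le_coeffNorm hQd (x := t) (abs_le.2 ⟨by linarith, by linarith⟩)
          rw [hQ, eval_comp_affine, eval_sub] at h3
          rw [hs₂ _ ⟨by nlinarith, hx.2⟩, ← sub_sub]
          refine (abs_sub _ _).trans ?_
          linarith)
      (fun x hx hxI => by
        rcases lt_or_ge x (z - h / 2) with hxl | hxl
        · rw [hs₁ _ ⟨hx.1, by linarith⟩,
            spl_eq_zero (by lia) fun w hw => hxl.le.trans (hνW w hw).2.1, add_zero, sub_self]
        · have hxr : z + h / 2 < x := by
            by_contra! hcon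
            exact hxI ⟨hxl, hcon⟩
          rw [hs₂ _ ⟨by linarith, hx.2⟩, spl_eq_eval fun w hw => (hνW w hw).2.2.trans hxr.le, hνQ,
            eval_sub, add_sub_cancel, sub_self]) p
    refine hup.trans (le_trans (le_of_eq ?_) (mul_le_mul_right hlow _))
    have he : 0 ≤ 1 / p.toReal := by positivity
    rw [ENNReal.ofReal_mul hh.le, ENNReal.mul_rpow_of_nonneg _ _ he,
      show z + h / 2 - (z - h / 2) = h by ring, ENNReal.ofReal_rpow_of_pos hρ]
    change _ = ENNReal.ofReal _ * _
    rw [mul_comm (ENNReal.ofReal h ^ _), ← mul_assoc, ← mul_assoc,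
      ← ENNReal.ofReal_mul (by positivity), ← ENNReal.ofReal_mul (by positivity)]
    congr 2
    rw [Real.rpow_neg hρ.le]
    have : ρ ^ (1 / p.toReal) ≠ 0 := by positivity
    field_simp

theorem IsPartition.le_of_le {n : ℕ} {z : ℕ → ℝ} (hz : IsPartition n z) {i j : ℕ} (hij : i ≤ j)
    (hj : j ≤ n) : z i ≤ z j := by
  induction j, hij using Nat.le_induction with
  | base => exact le_rfl
  | succ j hij ih => exact (ih (by lia)).trans (hz.2.2 j hj).le

theorem IsPartition.Icc_subset {n : ℕ} {z : ℕ → ℝ} (hz : IsPartition n z) {i j : ℕ} (hij : i ≤ j)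
    (hj : j ≤ n) : Set.Icc (z i) (z j) ⊆ Set.Icc (-1) 1 := by
  rw [← hz.1, ← hz.2.1]
  exact Set.Icc_subset_Icc (hz.le_of_le (Nat.zero_le i) (hij.trans hj)) (hz.le_of_le hj le_rfl)

theorem exists_mem_Ico_of_le_of_lt {m : ℕ} {w : ℕ → ℝ} {x : ℝ} (h0 : w 0 ≤ x) (hm : x < w m) :
    ∃ i < m, w i ≤ x ∧ x < w (i + 1) := by
  induction m with
  | zero => exact absurd h0 (not_le.2 hm)
  | succ m ih =>
    rcases lt_or_ge x (w m) with h | h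
    · obtain ⟨i, hi, h1⟩ := ih h
      exact ⟨i, by lia, h1⟩
    · exact ⟨m, by lia, h, hm⟩

/-- The knots of a `δ`-remesh are dense around each interior knot of the original partition. -/
theorem IsRemesh.meshed {δ : ℝ} {n m : ℕ} {z w : ℕ → ℝ} (hδ : 0 < δ)
    (hz : IsPartition n z) (hw : IsRemesh δ n z m w) {j : ℕ} (hj : j + 1 < n) {h : ℝ}
    (hh : h = min (z (j + 1) - z j) (z (j + 2) - z (j + 1))) :
    Meshed (w '' Set.Iic m) (δ * h) (z (j + 1) - h / 2) (z (j + 1) + h / 2) := by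
  intro x hx hx'
  have hl : z j < z (j + 1) := hz.2.2 j (by lia)
  have hr : z (j + 1) < z (j + 2) := hz.2.2 (j + 1) hj
  have hh0 : 0 < h := by rw [hh]; exact lt_min (by linarith) (by linarith)
  have hhl : h ≤ z (j + 1) - z j := by rw [hh]; exact min_le_left _ _
  have hhr : h ≤ z (j + 2) - z (j + 1) := by rw [hh]; exact min_le_right _ _
  have hpos : 0 < δ * h := mul_pos hδ hh0
  have hzj := hz.Icc_subset (i := j) (j := j + 2) (by lia) hj
  obtain ⟨hw0, hw1, hwi⟩ := hw.1
  have hx1 := hzj (show z j ∈ _ from ⟨le_rfl, by linarith⟩)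
  have hx2 := hzj (show z (j + 2) ∈ _ from ⟨by linarith, le_rfl⟩)
  obtain ⟨i, hi, hi1, hi2⟩ := exists_mem_Ico_of_le_of_lt (w := w) (m := m) (x := x)
    (by linarith [hx1.1]) (by linarith [hx2.2])
  have hlen : w (i + 1) - w i ≤ δ * h := by
    have key : w (i + 1) - w i ≤ δ * (z (j + 1) - z j) ∧
        w (i + 1) - w i ≤ δ * (z (j + 2) - z (j + 1)) := by
      rcases lt_or_ge x (z (j + 1)) with hxz | hxz
      · have h1 := hw.2 j (by lia) i hi ⟨x, ⟨hi1, hi2.le⟩, ⟨by linarith, hxz⟩⟩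
        exact ⟨h1 j (by lia) (Or.inr (Or.inl rfl)), h1 (j + 1) hj (Or.inr (Or.inr rfl))⟩
      · set y := min (w (i + 1)) (z (j + 2)) with hy
        have hy0 : x < y := lt_min hi2 (by linarith)
        have h1 := hw.2 (j + 1) hj i hi ⟨(x + y) / 2,
          ⟨by linarith, by linarith [min_le_left (w (i + 1)) (z (j + 2))]⟩,
          ⟨by linarith, by linarith [min_le_right (w (i + 1)) (z (j + 2))]⟩⟩
        exact ⟨h1 j (by lia) (Or.inl rfl), h1 (j + 1) hj (Or.inr (Or.inl rfl))⟩
    rw [hh]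
    rcases min_choice (z (j + 1) - z j) (z (j + 2) - z (j + 1)) with h | h <;> rw [h]
    exacts [key.1, key.2]
  exact ⟨w (i + 1), ⟨i + 1, hi, rfl⟩, hi2.le, by linarith⟩

/-- Telescoping of a sum of splines whose knots are arranged in consecutive groups. -/
theorem eval_add_sum_spl {k : ℕ} (hk : 1 ≤ k) (κ : ℝ) {N a b : ℕ} (hab : a ≤ b) (hb : b ≤ N)
    {p : ℕ → ℝ[X]} {μ : ℕ → ℝ →₀ ℝ} (hp : ∀ i < N, κ • powSum k (μ i) = p (i + 1) - p i) {x : ℝ}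
    (hleft : ∀ i < a, ∀ w ∈ (μ i).support, w ≤ x)
    (hright : ∀ i, b ≤ i → i < N → ∀ w ∈ (μ i).support, x ≤ w) :
    (p 0).eval x + κ * spl k (∑ i ∈ Finset.range N, μ i) x
      = (p a).eval x + ∑ i ∈ Finset.Ico a b, κ * spl k (μ i) x := by
  rw [map_sum, Finset.sum_apply, Finset.mul_sum, Finset.range_eq_Ico,
    ← Finset.sum_Ico_consecutive _ (Nat.zero_le a) (hab.trans hb),
    ← Finset.sum_Ico_consecutive _ hab hb]
  have h1 : ∑ i ∈ Finset.Ico b N, κ * spl k (μ i) x = 0 := Finset.sum_eq_zero fun i hi => by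
    rw [Finset.mem_Ico] at hi
    rw [spl_eq_zero hk (hright i hi.1 hi.2), mul_zero]
  have h2 : ∑ i ∈ Finset.Ico 0 a, κ * spl k (μ i) x = (p a).eval x - (p 0).eval x := by
    rw [← Finset.range_eq_Ico, ← Finset.sum_range_sub fun i => (p i).eval x]
    refine Finset.sum_congr rfl fun i hi => ?_
    rw [Finset.mem_range] at hi
    rw [spl_eq_eval (hleft i hi), ← smul_eq_mul, ← eval_smul, hp i (by lia), eval_sub]
  rw [h1, h2]
  ring

end SplineSmoothing

open Polynomial SplineSmoothing

theorem theorem1p1 (q r : ℕ) (hq : 1 ≤ q) (hr : 1 ≤ r) :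
    ∃ δ : ℝ, 0 < δ ∧ ∃ c : ENNReal → NNReal,
      ∀ (n : ℕ) (z : ℕ → ℝ), SplineSmoothing.IsPartition n z →
      ∀ s : ℝ → ℝ, SplineSmoothing.IsPPF (q + r) n z s →
        SplineSmoothing.QMonotoneOn q s (Set.Icc (-1) 1) →
        ContDiffOn ℝ ((q - 1 : ℕ) : ℕ∞) s (Set.Icc (-1) 1) →
      ∀ (m : ℕ) (w : ℕ → ℝ), SplineSmoothing.IsRemesh δ n z m w →
        ∃ s' : ℝ → ℝ,
          SplineSmoothing.IsMinDefectSpline (q + r) m w s' ∧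
          SplineSmoothing.QMonotoneOn q s' (Set.Icc (-1) 1) ∧
          ∀ p : ENNReal, 0 < p → ∀ j ≤ n,
            MeasureTheory.eLpNorm (fun x => s x - s' x) p
                (MeasureTheory.volume.restrict (SplineSmoothing.midInterval n z j)) ≤
              (c p : ENNReal) * SplineSmoothing.modulusOn (q + r + 1) s
                (SplineSmoothing.midInterval n z j) p := by
  obtain ⟨δ, hδ, K, hS⟩ := exists_smoothing_of_one_knot q r hr
  refine ⟨δ, hδ, K, fun n z hz s hs hmono hsmooth m w hw => ?_⟩
  have hn : 0 < n := by
    rcases Nat.eq_zero_or_pos n with rfl | h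
    · have h1 := hz.1
      rw [hz.2.1] at h1
      norm_num at h1
    · exact h
  choose! P hPd hP using hs
  have hsub : ∀ i < n, Set.Icc (z i) (z (i + 1)) ⊆ Set.Icc (-1) 1 := fun i hi =>
    hz.Icc_subset (Nat.le_succ i) hi
  have hder : ∀ i < n, ∀ l < q, ∀ x ∈ Set.Icc (z i) (z (i + 1)),
      iteratedDerivWithin l s (Set.Icc (-1) 1) x = (derivative^[l] (P i)).eval x :=
    fun i hi l hl x hx => iteratedDerivWithin_eq_of_eq_polynomial (by norm_num)
      (n := q - 1) (by exact_mod_cast hsmooth) (hz.2.2 i hi) (hsub i hi) (hP i hi) (by lia) hx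
  have hsP : ∀ i < n, ∀ x ∈ Set.Icc (z i) (z (i + 1)), s x = (P i).eval x := fun i hi x hx => by
    have := hder i hi 0 hq x hx
    simpa using this
  have hPpos : ∀ i < n, ∀ x ∈ Set.Icc (z i) (z (i + 1)), 0 ≤ (derivative^[q] (P i)).eval x :=
    fun i hi x hx => hmono.iterate_derivative_nonneg (hz.2.2 i hi) (hsub i hi) (hP i hi) hx
  set mid : ℕ → ℝ := fun i => (z i + z (i + 1)) / 2 with hmid
  have hmidle : ∀ i j, i ≤ j → j < n → mid i ≤ mid j := fun i j hij hj => by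
    have h1 := hz.le_of_le hij hj.le
    have h2 := hz.le_of_le (Nat.succ_le_succ hij) hj
    simp only [hmid]
    linarith
  have hmidmem : ∀ i < n, z i ≤ mid i ∧ mid i ≤ z (i + 1) := fun i hi => by
    have := hz.2.2 i hi
    constructor <;> simp only [hmid] <;> linarith
  have hknot : ∀ i, ∃ μ : ℝ →₀ ℝ, i < n - 1 →
      (∀ v ∈ μ.support, v ∈ w '' Set.Iic m ∧ v ∈ Set.Icc (mid i) (mid (i + 1))) ∧
      powSum (q + r) μ = P (i + 1) - P i ∧
      (∀ x ∈ Set.Icc (mid i) (mid (i + 1)),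
        0 ≤ (derivative^[q] (P i)).eval x + (q + r).descFactorial q * spl r μ x) ∧
      ∀ p : ℝ≥0∞, 0 < p →
        eLpNorm (fun x => s x - ((P i).eval x + spl (q + r) μ x)) p
          (volume.restrict (Set.Icc (mid i) (mid (i + 1))))
          ≤ K p * modulusOn (q + r + 1) s (Set.Icc (mid i) (mid (i + 1))) p := by
    intro i
    by_cases hi : i < n - 1
    swap
    · exact ⟨0, fun h => absurd h hi⟩
    have hi0 : i < n := by lia
    have hi1 : i + 1 < n := by lia
    have hl := hz.2.2 i hi0
    have hr' := hz.2.2 (i + 1) hi1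
    set h := min (z (i + 1) - z i) (z (i + 2) - z (i + 1)) with hh
    have hhl : h ≤ z (i + 1) - z i := min_le_left _ _
    have hhr : h ≤ z (i + 2) - z (i + 1) := min_le_right _ _
    have hzl : Set.Icc (mid i) (z (i + 1)) ⊆ Set.Icc (z i) (z (i + 1)) :=
      Set.Icc_subset_Icc_left (hmidmem i hi0).1
    have hzr : Set.Icc (z (i + 1)) (mid (i + 1)) ⊆ Set.Icc (z (i + 1)) (z (i + 1 + 1)) :=
      Set.Icc_subset_Icc_right (hmidmem (i + 1) hi1).2
    obtain ⟨μ, hμ⟩ := hS (z (i + 1)) h (mid i) (mid (i + 1))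
      (lt_min (by linarith) (by linarith)) (by simp only [hmid]; linarith)
      (by simp only [hmid]; linarith) (w '' Set.Iic m) (hw.meshed hδ hz hi1 hh)
      (P i) (P (i + 1)) (hPd i hi0) (hPd (i + 1) hi1)
      (fun l hl => by
        rw [iterate_derivative_sub, eval_sub,
          ← hder (i + 1) hi1 l hl _ ⟨le_rfl, hr'.le⟩, ← hder i hi0 l hl _ ⟨by linarith, le_rfl⟩,
          sub_self])
      (fun x hx => hPpos i hi0 x (hzl hx)) (fun x hx => hPpos (i + 1) hi1 x (hzr hx))
      s (fun x hx => hsP i hi0 x (hzl hx)) (fun x hx => hsP (i + 1) hi1 x (hzr hx))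
    exact ⟨μ, fun _ => hμ⟩
  choose μ hμ using hknot
  set M := ∑ i ∈ Finset.range (n - 1), μ i with hM
  set s' : ℝ → ℝ := fun x => (P 0).eval x + spl (q + r) M x with hs'
  set κ : ℝ := ((q + r).descFactorial q : ℝ) with hκ
  have hMW : ∀ v ∈ M.support, v ∈ w '' Set.Iic m := fun v hv => by
    classical
    obtain ⟨i, hi, hv'⟩ := Finset.mem_biUnion.1 (Finsupp.support_finsetSum hv)
    exact ((hμ i (Finset.mem_range.1 hi)).1 v hv').1
  have hleft : ∀ a, a ≤ n - 1 → ∀ x, mid a ≤ x → ∀ i < a, ∀ v ∈ (μ i).support, v ≤ x :=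
    fun a ha x hx i hi v hv =>
      (((hμ i (by lia)).1 v hv).2.2.trans (hmidle (i + 1) a hi (by lia))).trans hx
  have hright : ∀ b, b < n → ∀ x, x ≤ mid b → ∀ i, b ≤ i → i < n - 1 →
      ∀ v ∈ (μ i).support, x ≤ v := fun b hb x hx i hi hin v hv =>
    hx.trans ((hmidle b i hi (by lia)).trans ((hμ i hin).1 v hv).2.1)
  have htel : ∀ a b, a ≤ b → b ≤ n - 1 → ∀ x, (∀ i < a, ∀ v ∈ (μ i).support, v ≤ x) →
      (∀ i, b ≤ i → i < n - 1 → ∀ v ∈ (μ i).support, x ≤ v) →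
      s' x = (P a).eval x + ∑ i ∈ Finset.Ico a b, spl (q + r) (μ i) x := by
    intro a b hab hb x h1 h2
    have := eval_add_sum_spl (k := q + r) (by lia) 1 hab hb (p := P) (μ := μ)
      (fun i hi => by rw [one_smul, (hμ i hi).2.1]) h1 h2
    simpa only [one_mul] using this
  have htel' : ∀ a b, a ≤ b → b ≤ n - 1 → ∀ x, (∀ i < a, ∀ v ∈ (μ i).support, v ≤ x) →
      (∀ i, b ≤ i → i < n - 1 → ∀ v ∈ (μ i).support, x ≤ v) →
      (derivative^[q] (P 0)).eval x + κ * spl r M x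
        = (derivative^[q] (P a)).eval x + ∑ i ∈ Finset.Ico a b, κ * spl r (μ i) x :=
    fun a b hab hb x h1 h2 => eval_add_sum_spl hr κ hab hb (p := fun i => derivative^[q] (P i))
      (fun i hi => by
        rw [← iterate_derivative_powSum, (hμ i hi).2.1, iterate_derivative_sub]) h1 h2
  have hcd : ContDiff ℝ ((q + r - 1 : ℕ) : ℕ∞) s' := by
    refine (contDiff_eval (P 0)).add ?_
    have := contDiff_spl (q + r - 1) M
    rw [Nat.sub_add_cancel (by lia)] at this
    exact_mod_cast this
  have hcdq : ContDiff ℝ q s' := hcd.of_le (by exact_mod_cast (by lia : q ≤ q + r - 1))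
  have hsplq : ContDiff ℝ q (spl (q + r) M) := by
    have := contDiff_spl (q + r - 1) M
    rw [Nat.sub_add_cancel (by lia)] at this
    exact this.of_le (by exact_mod_cast (by lia : q ≤ q + r - 1))
  have hids : ∀ x, iteratedDeriv q s' x = (derivative^[q] (P 0)).eval x + κ * spl r M x := by
    intro x
    rw [hs', iteratedDeriv_fun_add (contDiff_eval _).contDiffAt hsplq.contDiffAt,
      iteratedDeriv_eval, iteratedDeriv_spl q r hr]
    rfl
  refine ⟨s', ⟨fun i hi => ?_, hcd.contDiffOn⟩, ?_, fun p hp j hj => ?_⟩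
  · obtain ⟨R, hRd, hR⟩ := exists_polynomial_eq_spl (k := q + r) (by lia) M (a := w i)
      (b := w (i + 1)) fun v hv hv' => by
        obtain ⟨l, hl, rfl⟩ := hMW v hv
        rcases le_or_gt l i with h | h
        · exact absurd (hw.1.le_of_le h hi.le) (not_le.2 hv'.1)
        · exact absurd (hw.1.le_of_le h hl) (not_le.2 hv'.2)
    refine ⟨P 0 + R, (natDegree_add_le _ _).trans (max_le (hPd 0 hn) hRd), fun x hx => ?_⟩
    rw [hs', eval_add]
    simp only [hR x hx]
  · refine qMonotoneOn_of_iteratedDeriv_nonneg q hcdq fun x hx => ?_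
    rw [hids]
    rcases le_or_gt x (mid 0) with h0 | h0
    · rw [htel' 0 0 le_rfl (Nat.zero_le _) x (by simp) (hright 0 hn x h0)]
      simp only [Finset.Ico_self, Finset.sum_empty, add_zero]
      refine hPpos 0 hn x ⟨by rw [hz.1]; exact hx.1, h0.trans (hmidmem 0 hn).2⟩
    rcases le_or_gt (mid (n - 1)) x with h1 | h1
    · rw [htel' (n - 1) (n - 1) le_rfl le_rfl x (hleft (n - 1) le_rfl x h1)
        fun i h2 h3 => absurd h3 (by lia)]
      simp only [Finset.Ico_self, Finset.sum_empty, add_zero]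
      refine hPpos (n - 1) (by lia) x ⟨(hmidmem (n - 1) (by lia)).1.trans h1, ?_⟩
      rw [Nat.sub_add_cancel hn, hz.2.1]
      exact hx.2
    · obtain ⟨i, hi, hi1, hi2⟩ := exists_mem_Ico_of_le_of_lt (w := mid) h0.le h1
      rw [htel' i (i + 1) (by lia) (by lia) x (hleft i hi.le x hi1)
        (hright (i + 1) (by lia) x hi2.le)]
      simp only [Nat.Ico_succ_singleton, Finset.sum_singleton]
      exact (hμ i hi).2.2.1 x ⟨hi1, hi2.le⟩
  · have hzero : ∀ J : Set ℝ, MeasurableSet J → (∀ x ∈ J, s x = s' x) →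
        eLpNorm (fun x => s x - s' x) p (volume.restrict J) = 0 := fun J hJ h => by
      rw [eLpNorm_congr_ae (g := fun _ => (0 : ℝ))
        (ae_restrict_of_forall_mem hJ fun x hx => sub_eq_zero.2 (h x hx))]
      exact eLpNorm_zero
    rcases Nat.eq_zero_or_pos j with rfl | hj0
    · rw [hzero (midInterval n z 0) measurableSet_Icc fun x hx => ?_]
      · exact bot_le
      · have hx0 : z 0 ≤ x := by
          have := hx.1
          simp only [Nat.zero_sub] at this
          linarith
        have hx1 : x ≤ mid 0 := by
          have := hx.2
          rwa [Nat.zero_add, min_eq_left (by lia : 1 ≤ n)] at this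
        rw [htel 0 0 le_rfl (Nat.zero_le _) x (by simp) (hright 0 hn x hx1)]
        simp only [Finset.Ico_self, Finset.sum_empty, add_zero]
        exact hsP 0 hn x ⟨hx0, hx1.trans (hmidmem 0 hn).2⟩
    obtain ⟨i, rfl⟩ : ∃ i, j = i + 1 := ⟨j - 1, by lia⟩
    rcases eq_or_lt_of_le hj with hjn | hjn
    · rw [hzero (midInterval n z (i + 1)) measurableSet_Icc fun x hx => ?_]
      · exact bot_le
      · have hx0 : mid i ≤ x := hx.1
        have hx1 : x ≤ z (i + 1) := by
          have := hx.2
          rw [min_eq_right (by lia), ← hjn] at this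
          linarith
        rw [htel i i le_rfl (by lia) x (hleft i (by lia) x hx0)
          fun l h2 h3 => absurd h3 (by lia)]
        simp only [Finset.Ico_self, Finset.sum_empty, add_zero]
        exact hsP i (by lia) x ⟨(hmidmem i (by lia)).1.trans hx0, hx1⟩
    · have hJ : midInterval n z (i + 1) = Set.Icc (mid i) (mid (i + 1)) := by
        rw [midInterval, min_eq_left (by lia)]
        rfl
      rw [hJ]
      refine le_trans (le_of_eq (eLpNorm_congr_ae ?_)) ((hμ i (by lia)).2.2.2 p hp)
      refine ae_restrict_of_forall_mem measurableSet_Icc fun x hx => ?_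
      simp only
      rw [htel i (i + 1) (by lia) (by lia) x (hleft i (by lia) x hx.1)
        (hright (i + 1) hjn x hx.2)]
      simp only [Nat.Ico_succ_singleton, Finset.sum_singleton]
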